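/- All graphs are finite and simple; $\delta(G)$ denotes the minimum degree of $G$. A graph is $K_{1,r}$-free if it has no induced subgraph isomorphic to the star $K_{1,r}$ (one centre joined to $r$ pairwise nonadjacent leaves). A $\mathcal{P}_{\geq 3}$-factor of $G$ is a spanning subgraph of $G$ each of whose connected components is a path on at least $3$ vertices. Theorem. Let $r\ge 3$ be an integer. (i) Every $K_{1,r}$-free graph $G$ with $\delta(G)\ge\lfloor r/2\rfloor+1$ has a $\mathcal{P}_{\geq 3}$-factor. (For $r=3$ this is Kaneko's result that every claw-free graph with minimum degree at least $2$ has a $\mathcal{P}_{\geq 3}$-factor.) (ii) The bound in (i) is best possible: there is a $K_{1,r}$-free graph $G$ with $\delta(G)=\lfloor r/2\rfloor$ that has no $\mathcal{P}_{\geq 3}$-factor. -/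

import Mathlib

/-- `G` is `K_{1,r}`-free: no induced subgraph of `G` is isomorphic to the star `K_{1,r}`. -/
def SimpleGraph.IsStarFree {V : Type*} (G : SimpleGraph V) (r : ℕ) : Prop :=
  ¬ (completeBipartiteGraph (Fin 1) (Fin r)).IsIndContained G

/-- `H` is a `P_{≥ k}`-factor of `G`: a spanning subgraph of `G` (same vertex set, edges among
those of `G`), each connected component of which is isomorphic to a path on at least `k`
vertices (`SimpleGraph.pathGraph n` is the path on `n` vertices). -/
def SimpleGraph.IsPathFactor {V : Type*} (G : SimpleGraph V) (k : ℕ) (H : SimpleGraph V) : Prop :=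
  H ≤ G ∧ ∀ C : H.ConnectedComponent,
    ∃ n : ℕ, k ≤ n ∧ Nonempty (C.toSimpleGraph ≃g SimpleGraph.pathGraph n)

/-- `G` has a `P_{≥ k}`-factor. -/
def SimpleGraph.HasPathFactor {V : Type*} (G : SimpleGraph V) (k : ℕ) : Prop :=
  ∃ H : SimpleGraph V, G.IsPathFactor k H

namespace PathCover

open Finset

/-! Part (i) combines the sufficiency half of Kaneko's criterion (`cov_of_forall_card_suns_le`) with
a double count. The criterion: `W` splits into paths on at least three vertices as soon as deleting
any `S ⊆ W` leaves at most `2|S|` sun components. Suns enter only through two local properties: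
every vertex starts a path on one or two vertices whose removal leaves a coverable set, and every
vertex is a leaf or has a leaf neighbour.

The core is `dichotomy`, by induction on vertices plus edges. If a nonempty `S` attains equality,
Hall's theorem gives each `s ∈ S` two suns, which `s` links into a path; the other components are
coverable by induction. Otherwise let `W` be uncoverable. Whenever `S` is near-tight, that is,
misses equality by one, each `s ∈ S` has a neighbour whose only neighbour in `W` is `s`
(`leafed_of_near_tight`). If all vertices are leaves or next to leaves, `W` is a sun. If not, delete
an edge `xy` at an offending `y`. A bridge separates two coverable sides (`cov_of_bridge`); a
smaller graph obeying the bound yields a cover directly or after restoring `xy`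
(`cov_of_sun_deleteEdge`); a violated bound produces near-tight sets, and from them a cover
(`false_of_lt_card_suns_deleteEdge`).

In a star-free graph, choose a leaf in each sun. It has at least `⌊r/2⌋` neighbours in `S`, while
each `s` sees at most `r - 1` of these pairwise nonadjacent leaves, and `r - 1 ≤ 2⌊r/2⌋`.

For sharpness, join a clique on `p = ⌊r/2⌋ - 1` vertices to `2p + 1` disjoint edges. A factor must
link every edge to the clique, whose vertices have degree at most two in it. -/

/-- A path of `G`, given as the list of its vertices. -/
def IsPathList {V : Type*} (G : SimpleGraph V) (p : List V) : Prop :=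
  p.IsChain G.Adj ∧ p.Nodup

/-- The vertices of `W` can be partitioned into paths of `G` with at least three vertices. -/
inductive Cov {V : Type*} [DecidableEq V] (G : SimpleGraph V) : Finset V → Prop
  | empty : Cov G ∅
  | cons (p : List V) (W : Finset V) (hp : IsPathList G p) (h3 : 3 ≤ p.length)
      (hd : Disjoint p.toFinset W) (hW : Cov G W) : Cov G (p.toFinset ∪ W)

/-! ### Paths as vertex lists, and leaves -/

section Lists

variable {V : Type*} {G : SimpleGraph V}

theorem IsPathList.mono {H : SimpleGraph V} (h : G ≤ H) {p : List V} (hp : IsPathList G p) :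
    IsPathList H p :=
  ⟨hp.1.imp fun _ _ hab => h hab, hp.2⟩

theorem IsPathList.reverse {p : List V} (hp : IsPathList G p) : IsPathList G p.reverse :=
  ⟨List.isChain_reverse.2 (hp.1.imp fun _ _ hab => hab.symm), List.nodup_reverse.2 hp.2⟩

theorem isPathList_singleton (v : V) : IsPathList G [v] := ⟨by simp, by simp⟩

theorem isPathList_cons_cons {a b : V} {l : List V} :
    IsPathList G (a :: b :: l) ↔ G.Adj a b ∧ a ∉ b :: l ∧ IsPathList G (b :: l) := by
  simp only [IsPathList, List.isChain_cons_cons, List.nodup_cons (a := a)]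
  tauto

theorem IsPathList.append {l₁ l₂ : List V} {a b : V} (h₁ : IsPathList G (l₁ ++ [a]))
    (h₂ : IsPathList G (b :: l₂)) (hab : G.Adj a b)
    (hd : ∀ x ∈ l₁ ++ [a], x ∉ b :: l₂) : IsPathList G ((l₁ ++ [a]) ++ b :: l₂) := by
  refine ⟨?_, ?_⟩
  · rw [List.isChain_append]
    refine ⟨h₁.1, h₂.1, ?_⟩
    intro x hx y hy
    simp at hx hy
    subst hx hy
    exact hab
  · rw [List.nodup_append]
    refine ⟨h₁.2, h₂.2, ?_⟩
    intro x hx y hy hxy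
    exact hd x hx (hxy ▸ hy)

/-- `v` has at most one neighbour in `C`. -/
def Leaf {V : Type*} (G : SimpleGraph V) (C : Finset V) (v : V) : Prop :=
  ∀ x ∈ C, ∀ y ∈ C, G.Adj v x → G.Adj v y → x = y

/-- `v` is adjacent to a leaf of `C`. -/
def Leafed {V : Type*} (G : SimpleGraph V) (C : Finset V) (v : V) : Prop :=
  ∃ w ∈ C, G.Adj v w ∧ Leaf G C w

/-- An inner vertex of a path has two distinct neighbours on it, so a leaf is an end; reverse the
path if it is the last vertex. -/
theorem Leaf.exists_eq_cons {C : Finset V} {v : V} (hl : Leaf G C v) {p : List V}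
    (hp : IsPathList G p) (hv : v ∈ p) (hC : ∀ x ∈ p, x ∈ C) :
    ∃ q, IsPathList G (v :: q) ∧ (∀ x, x ∈ v :: q ↔ x ∈ p) ∧ (v :: q).length = p.length := by
  obtain ⟨l₁, l₂, rfl⟩ := List.append_of_mem hv
  rcases List.eq_nil_or_concat l₁ with rfl | ⟨l₁, a, rfl⟩
  · exact ⟨l₂, by simpa using hp, by simp, by simp⟩
  rcases l₂ with _ | ⟨b, l₂⟩
  · refine ⟨(l₁.concat a).reverse, ?_, ?_, by simp⟩
    · have := hp.reverse
      simpa using this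
    · intro x
      simp
      tauto
  · exfalso
    have hab : a = b := by
      have h1 := hp.1
      simp only [List.concat_eq_append, List.append_assoc, List.singleton_append] at h1
      rw [List.isChain_append_cons_cons, List.isChain_cons_cons] at h1
      exact hl a (hC a (by simp)) b (hC b (by simp)) h1.2.1.symm h1.2.2.1
    have := hp.2
    subst hab
    simp [List.nodup_append] at this

end Lists

/-! ### Coverable sets and gluing of paths -/

section Covers

variable {V : Type*} [DecidableEq V] {G : SimpleGraph V}

theorem Cov.mono {H : SimpleGraph V} (h : G ≤ H) {W : Finset V} (hW : Cov G W) : Cov H W := by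
  induction hW with
  | empty => exact .empty
  | cons p W hp h3 hd _ ih => exact .cons p W (hp.mono h) h3 hd ih

theorem Cov.of_path_union {p : List V} (hp : IsPathList G p) (h3 : 3 ≤ p.length) {W T : Finset V}
    (hW : Cov G W) (hd : ∀ x ∈ p, x ∉ W) (hT : ∀ x, x ∈ T ↔ x ∈ p ∨ x ∈ W) : Cov G T := by
  have : T = p.toFinset ∪ W := by ext x; simp [hT]
  rw [this]
  exact .cons p W hp h3 (disjoint_left.2 fun x hx => hd x (by simpa using hx)) hW

theorem Cov.union {A B : Finset V} (hA : Cov G A) (hB : Cov G B) (hd : Disjoint A B) :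
    Cov G (A ∪ B) := by
  induction hA with
  | empty => simpa using hB
  | cons p W hp h3 hpW _ ih =>
    rw [disjoint_union_left] at hd
    rw [union_assoc]
    exact .cons p _ hp h3 (disjoint_union_right.2 ⟨hpW, hd.1⟩) (ih hd.2)

theorem Cov.biUnion {ι : Type*} [DecidableEq ι] {I : Finset ι} {P : ι → Finset V}
    (hP : ∀ i ∈ I, Cov G (P i)) (hd : ∀ i ∈ I, ∀ j ∈ I, i ≠ j → Disjoint (P i) (P j)) :
    Cov G (I.biUnion P) := by
  induction I using Finset.induction_on with
  | empty => simpa using Cov.empty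
  | insert i I hi ih =>
    rw [biUnion_insert]
    refine (hP i (by simp)).union (ih (fun j hj => hP j (by simp [hj]))
      fun j hj k hk => hd j (by simp [hj]) k (by simp [hk])) ?_
    rw [disjoint_biUnion_right]
    intro j hj
    exact hd i (by simp) j (by simp [hj]) fun h => hi (h ▸ hj)

theorem Cov.exists_path {W : Finset V} (hW : Cov G W) {v : V} (hv : v ∈ W) :
    ∃ p : List V, IsPathList G p ∧ 3 ≤ p.length ∧ v ∈ p ∧ (∀ x ∈ p, x ∈ W) ∧
      Cov G (W \ p.toFinset) := by
  induction hW with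
  | empty => simp at hv
  | cons p W hp h3 hd hW ih =>
    by_cases hvp : v ∈ p
    · refine ⟨p, hp, h3, hvp, fun x hx => by simp [hx], ?_⟩
      rwa [union_sdiff_cancel_left hd]
    · obtain ⟨q, hq, hq3, hvq, hqW, hc⟩ := ih (by simpa [hvp] using hv)
      refine ⟨q, hq, hq3, hvq, fun x hx => by simp [hqW x hx], ?_⟩
      have hd' := disjoint_left.1 hd
      refine Cov.of_path_union hp h3 hc (fun x hx => ?_) fun x => ?_
      · have := hd' (by simpa using hx)
        simp [this]
      · have : x ∈ p → x ∉ q := fun hx hxq => hd' (by simpa using hx) (hqW x hxq)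
        simp
        tauto

/-- A leaf is an end of the covering path through it, so that path can be prolonged there. -/
theorem Cov.append_at_leaf {W T : Finset V} (hW : Cov G W) {v a : V} (hv : v ∈ W)
    (hl : Leaf G W v) {l : List V} (hp : IsPathList G (l ++ [a])) (hav : G.Adj a v)
    (hd : ∀ x ∈ l ++ [a], x ∉ W) (hT : ∀ x, x ∈ T ↔ x ∈ l ++ [a] ∨ x ∈ W) : Cov G T := by
  obtain ⟨p, hpp, h3, hvp, hpW, hc⟩ := hW.exists_path hv
  obtain ⟨q, hq, hqp, hlen⟩ := hl.exists_eq_cons hpp hvp hpW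
  refine Cov.of_path_union (hp.append hq hav fun x hx hxq => hd x hx (hpW x ((hqp x).1 hxq)))
    ?_ hc ?_ ?_
  · rw [List.length_append, hlen]; omega
  · intro x hx
    rw [List.mem_append, hqp] at hx
    simp only [mem_sdiff, List.mem_toFinset, not_and, not_not]
    rcases hx with hx | hx
    · exact fun h => absurd h (hd x hx)
    · exact fun _ => hx
  · intro x
    rw [hT, List.mem_append (s := l ++ [a]), hqp, mem_sdiff, List.mem_toFinset]
    have := hpW x
    tauto

/-- `C` is `{v}`, or removing both ends of some edge of `C` at `v` leaves a coverable set. -/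
def Root {V : Type*} [DecidableEq V] (G : SimpleGraph V) (C : Finset V) (v : V) : Prop :=
  C = {v} ∨ ∃ w ∈ C, G.Adj v w ∧ Cov G ((C.erase v).erase w)

/-- Gives both kinds of root one shape, so that gluing needs no case split. The last clause says
that a one-vertex path exhausts `C`. -/
theorem Root.exists_list {C : Finset V} {v : V} (hv : v ∈ C) (h : Root G C v) :
    ∃ q, IsPathList G (v :: q) ∧ q.length ≤ 1 ∧ (∀ x ∈ v :: q, x ∈ C) ∧
      Cov G (C \ (v :: q).toFinset) ∧ (q = [] → C = {v}) := by
  rcases h with rfl | ⟨w, hw, hvw, hc⟩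
  · exact ⟨[], isPathList_singleton v, by simp, by simp, by simpa using Cov.empty, by simp⟩
  · refine ⟨[w], isPathList_cons_cons.2 ⟨hvw, by simpa using hvw.ne, isPathList_singleton w⟩,
      by simp, by simp [hv, hw], ?_, by simp⟩
    convert hc using 1
    ext x
    simp
    tauto

theorem Root.join_left {C : Finset V} {z : V} (hz : z ∈ C) (h : Root G C z) {l : List V} {a : V}
    (hp : IsPathList G (l ++ [a])) (haz : G.Adj a z) (hd : ∀ x ∈ l ++ [a], x ∉ C)
    (hl : 1 ≤ l.length ∨ 2 ≤ C.card) {T : Finset V}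
    (hT : ∀ x, x ∈ T ↔ x ∈ l ++ [a] ∨ x ∈ C) : Cov G T := by
  obtain ⟨q, hq, -, hqC, hc, hnil⟩ := h.exists_list hz
  refine Cov.of_path_union (hp.append hq haz fun x hx hxq => hd x hx (hqC x hxq)) ?_ hc ?_ ?_
  · rcases hl with hl | hl
    · simp; omega
    · have : q ≠ [] := fun h => by simp [hnil h] at hl
      have := List.length_pos_of_ne_nil this
      simp; omega
  · intro x hx
    rw [List.mem_append] at hx
    rw [mem_sdiff, List.mem_toFinset]
    rintro ⟨h1, h2⟩
    rcases hx with hx | hx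
    · exact hd x hx h1
    · exact h2 hx
  · intro x
    rw [hT, List.mem_append (s := l ++ [a]), mem_sdiff, List.mem_toFinset]
    have := hqC x
    tauto

/-- The middle path and a root on each side already make three vertices, so even two singleton suns
can be linked through one vertex. -/
theorem Root.join_both {C₁ C₂ : Finset V} {z₁ z₂ : V} (hz₁ : z₁ ∈ C₁) (h₁ : Root G C₁ z₁)
    (hz₂ : z₂ ∈ C₂) (h₂ : Root G C₂ z₂) (hC : Disjoint C₁ C₂) {l : List V} {a b : V}
    (hp : IsPathList G (b :: l)) (hlast : ∃ l', b :: l = l' ++ [a]) (hb : G.Adj z₁ b)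
    (ha : G.Adj a z₂) (hd₁ : ∀ x ∈ b :: l, x ∉ C₁) (hd₂ : ∀ x ∈ b :: l, x ∉ C₂) {T : Finset V}
    (hT : ∀ x, x ∈ T ↔ x ∈ b :: l ∨ x ∈ C₁ ∨ x ∈ C₂) : Cov G T := by
  obtain ⟨q₁, hq₁, -, hqC₁, hc₁, -⟩ := h₁.exists_list hz₁
  obtain ⟨q₂, hq₂, -, hqC₂, hc₂, -⟩ := h₂.exists_list hz₂
  obtain ⟨l', hl'⟩ := hlast
  have hd := disjoint_left.1 hC
  have hr := hq₁.reverse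
  rw [List.reverse_cons] at hr
  have hm₁ : ∀ x, x ∈ q₁.reverse ++ [z₁] ↔ x ∈ z₁ :: q₁ := fun x => by simp; tauto
  have h1 := hr.append hp hb fun x hx hx' => hd₁ x hx' (hqC₁ x ((hm₁ x).1 hx))
  rw [hl', ← List.append_assoc] at h1
  have h2 := h1.append hq₂ ha fun x hx hx' => by
    rw [List.append_assoc, ← hl', List.mem_append, hm₁] at hx
    rcases hx with hx | hx
    · exact hd (hqC₁ x hx) (hqC₂ x hx')
    · exact hd₂ x hx (hqC₂ x hx')
  have hmem : ∀ x, x ∈ ((q₁.reverse ++ [z₁]) ++ l') ++ [a] ++ z₂ :: q₂ ↔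
      x ∈ z₁ :: q₁ ∨ x ∈ b :: l ∨ x ∈ z₂ :: q₂ := fun x => by
    rw [List.append_assoc (q₁.reverse ++ [z₁]), ← hl', List.mem_append, List.mem_append, hm₁]
    tauto
  refine Cov.of_path_union h2 (by simp; omega) (hc₁.union hc₂ ?_) ?_ ?_
  · exact hC.mono sdiff_subset sdiff_subset
  · intro x hx
    rw [hmem] at hx
    rw [mem_union, mem_sdiff, mem_sdiff, List.mem_toFinset, List.mem_toFinset]
    have := hqC₁ x
    have := hqC₂ x
    have := hd₁ x
    have := hd₂ x
    have := @hd x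
    tauto
  · intro x
    rw [hmem, hT, mem_union, mem_sdiff, mem_sdiff, List.mem_toFinset, List.mem_toFinset]
    have := hqC₁ x
    have := hqC₂ x
    tauto

end Covers

end PathCover

/-! ### Hall's theorem with capacities; components and suns -/

namespace PathCover

open Finset

/-- Hall's theorem after replacing each `s` by `c s` copies. -/
theorem exists_assignment_of_capacity {ι α : Type*} [DecidableEq ι] [DecidableEq α] [Nonempty α]
    (I : Finset ι) (N : ι → Finset α) (c : α → ℕ)
    (h : ∀ A ⊆ I, A.card ≤ ∑ s ∈ A.biUnion N, c s) :
    ∃ f : ι → α, (∀ i ∈ I, f i ∈ N i) ∧ ∀ s, (I.filter (f · = s)).card ≤ c s := by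
  classical
  let t : I → Finset (Σ _ : α, ℕ) := fun i => (N i).sigma fun s => range (c s)
  have hall : ∀ A : Finset I, A.card ≤ (A.biUnion t).card := by
    intro A
    have hA : A.biUnion t = ((A.map (Function.Embedding.subtype _)).biUnion N).sigma
        fun s => range (c s) := by
      ext ⟨s, k⟩
      simp [t]
      grind
    rw [hA, card_sigma]
    simp only [card_range]
    refine le_trans (by simp) (h _ ?_)
    intro x hx
    simp at hx
    exact hx.1
  obtain ⟨g, hg, hgt⟩ := (Finset.all_card_le_biUnion_card_iff_exists_injective t).1 hall
  refine ⟨fun i => if hi : i ∈ I then (g ⟨i, hi⟩).1 else Classical.arbitrary α, ?_, ?_⟩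
  · intro i hi
    have := hgt ⟨i, hi⟩
    simp only [t, mem_sigma] at this
    simpa [hi] using this.1
  · intro s
    rw [← card_range (c s)]
    refine card_le_card_of_injOn
      (fun i => if hi : i ∈ I then (g ⟨i, hi⟩).2 else 0) ?_ ?_
    · intro i hi
      simp only [coe_filter, Set.mem_ofPred_eq] at hi
      obtain ⟨hi, his⟩ := hi
      simp only [hi, dite_true] at his
      have := hgt ⟨i, hi⟩
      simp only [t, mem_sigma, his] at this
      simpa [hi] using this.2
    · intro i hi j hj hij
      simp only [coe_filter, Set.mem_ofPred_eq] at hi hj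
      obtain ⟨hi, his⟩ := hi
      obtain ⟨hj, hjs⟩ := hj
      simp only [hi, hj, dite_true] at his hjs hij
      have : g ⟨i, hi⟩ = g ⟨j, hj⟩ := Sigma.ext (his.trans hjs.symm) (heq_of_eq hij)
      simpa using hg this

/-- The fibres are bounded by the capacities and have the same total, so every bound is an equality.
-/
theorem exists_exact_assignment {ι α : Type*} [DecidableEq ι] [DecidableEq α] [Nonempty α]
    (I : Finset ι) (S : Finset α) (N : ι → Finset α) (c : α → ℕ)
    (hN : ∀ i ∈ I, N i ⊆ S) (hcard : I.card = ∑ s ∈ S, c s)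
    (h : ∀ A ⊆ I, A.card ≤ ∑ s ∈ A.biUnion N, c s) :
    ∃ f : ι → α, (∀ i ∈ I, f i ∈ N i) ∧ ∀ s ∈ S, (I.filter (f · = s)).card = c s := by
  obtain ⟨f, hf, hc⟩ := exists_assignment_of_capacity I N c h
  refine ⟨f, hf, ?_⟩
  rw [card_eq_sum_card_fiberwise (fun i hi => hN i hi (hf i hi))] at hcard
  exact (sum_eq_sum_iff_of_le fun s _ => hc s).1 hcard

section Components

variable {V : Type*} {G : SimpleGraph V}

/-- The subgraph of `G` induced by `C` is connected. -/
def Conn {V : Type*} (G : SimpleGraph V) (C : Finset V) : Prop :=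
  C.Nonempty ∧ ∀ A ⊆ C, A.Nonempty → A ≠ C → ∃ a ∈ A, ∃ b ∈ C, b ∉ A ∧ G.Adj a b

/-- `C` is the vertex set of a connected component of the subgraph induced by `W`. -/
structure IsComp {V : Type*} (G : SimpleGraph V) (W C : Finset V) : Prop where
  subset : C ⊆ W
  conn : Conn G C
  closed : ∀ a ∈ C, ∀ b ∈ W, G.Adj a b → b ∈ C

theorem Conn.subset_of_closed {C D : Finset V} (hC : Conn G C) {x : V} (hxC : x ∈ C) (hxD : x ∈ D)
    (hD : ∀ a ∈ D, ∀ b ∈ C, G.Adj a b → b ∈ D) : C ⊆ D := by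
  classical
  by_contra hCD
  obtain ⟨a, ha, b, hb, hbD, hab⟩ := hC.2 (C.filter (· ∈ D)) (filter_subset _ _)
    ⟨x, by simp [hxC, hxD]⟩ fun h => hCD (filter_eq_self.1 h)
  simp only [mem_filter] at ha hbD
  exact hbD ⟨hb, hD a ha.2 b hb hab⟩

theorem IsComp.eq_of_mem {W C D : Finset V} (hC : IsComp G W C) (hD : IsComp G W D) {x : V}
    (hxC : x ∈ C) (hxD : x ∈ D) : C = D :=
  Subset.antisymm
    (hC.conn.subset_of_closed hxC hxD fun a ha b hb => hD.closed a ha b (hC.subset hb))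
    (hD.conn.subset_of_closed hxD hxC fun a ha b hb => hC.closed a ha b (hD.subset hb))

theorem IsComp.disjoint {W C D : Finset V} (hC : IsComp G W C) (hD : IsComp G W D) (h : C ≠ D) :
    Disjoint C D :=
  disjoint_left.2 fun _ hxC hxD => h (hC.eq_of_mem hD hxC hxD)

theorem exists_isComp {W : Finset V} {x : V} (hx : x ∈ W) : ∃ C, IsComp G W C ∧ x ∈ C := by
  classical
  -- The component is a smallest closed set containing `x`: a nonempty proper part `A` with no edge
  -- to the rest would make `A` or `C \ A` a smaller one.
  let F := W.powerset.filter fun C => x ∈ C ∧ ∀ a ∈ C, ∀ b ∈ W, G.Adj a b → b ∈ C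
  obtain ⟨C, hC, hmin⟩ := exists_min_image F card ⟨W, by simp +contextual [F, hx]⟩
  simp only [F, mem_filter, mem_powerset] at hC hmin
  obtain ⟨hCW, hxC, hcl⟩ := hC
  refine ⟨C, ⟨hCW, ⟨⟨x, hxC⟩, ?_⟩, hcl⟩, hxC⟩
  intro A hAC hA hne
  by_contra! hno
  have hss : A ⊂ C := lt_of_le_of_ne hAC hne
  by_cases hxA : x ∈ A
  · have := hmin A ⟨hAC.trans hCW, hxA, fun a ha b hb hab =>
      by_contra fun hbA => hno a ha b (hcl a (hAC ha) b hb hab) hbA hab⟩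
    exact absurd (card_lt_card hss) (by omega)
  · have := hmin (C \ A) ⟨sdiff_subset.trans hCW, by simp [hxC, hxA], fun a ha b hb hab => by
      rw [mem_sdiff] at ha ⊢
      exact ⟨hcl a ha.1 b hb hab, fun hbA => hno b hbA a ha.1 ha.2 hab.symm⟩⟩
    have h2 : C \ A ⊂ C := sdiff_ssubset hAC hA
    exact absurd (card_lt_card h2) (by omega)

/-- A component survives the removal of further vertices outside of it. -/
theorem IsComp.anti {W W' C : Finset V} (hC : IsComp G W C) (hW : W' ⊆ W) (hCW : C ⊆ W') :
    IsComp G W' C :=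
  ⟨hCW, hC.conn, fun a ha b hb => hC.closed a ha b (hW hb)⟩

theorem IsComp.of_closed {W D C : Finset V} (hC : IsComp G D C) (hDW : D ⊆ W)
    (hD : ∀ a ∈ C, ∀ b ∈ W, G.Adj a b → b ∈ D) : IsComp G W C :=
  ⟨hC.subset.trans hDW, hC.conn, fun a ha b hb hab => hC.closed a ha b (hD a ha b hb hab) hab⟩

theorem Conn.eq_of_isComp {W C : Finset V} (hW : Conn G W) (hC : IsComp G W C) : C = W := by
  obtain ⟨x, hx⟩ := hC.conn.1
  exact Subset.antisymm hC.subset (hW.subset_of_closed (hC.subset hx) hx hC.closed)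

theorem conn_singleton (v : V) : Conn G {v} :=
  ⟨singleton_nonempty v, fun _ hA hne h => absurd ((subset_singleton_iff.1 hA).resolve_left
    hne.ne_empty) h⟩

theorem isComp_singleton {W : Finset V} {v : V} (hv : v ∈ W) (h : ∀ b ∈ W, ¬ G.Adj v b) :
    IsComp G W {v} :=
  ⟨by simpa using hv, conn_singleton v, fun a ha b hb hab => by
    rw [mem_singleton] at ha
    exact absurd (ha ▸ hab) (h b hb)⟩

theorem Conn.congr {H : SimpleGraph V} {C : Finset V} (hC : Conn G C)
    (h : ∀ a ∈ C, ∀ b ∈ C, G.Adj a b → H.Adj a b) : Conn H C :=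
  ⟨hC.1, fun A hA hne hAC => by
    obtain ⟨a, ha, b, hb, hbA, hab⟩ := hC.2 A hA hne hAC
    exact ⟨a, ha, b, hb, hbA, h a (hA ha) b hb hab⟩⟩

theorem Cov.of_components [DecidableEq V] {W : Finset V}
    (h : ∀ C, IsComp G W C → Cov G C) : Cov G W := by
  induction W using Finset.strongInduction with
  | H W ih =>
    rcases W.eq_empty_or_nonempty with rfl | ⟨x, hx⟩
    · exact .empty
    obtain ⟨C, hC, hxC⟩ := exists_isComp (G := G) hx
    have h1 : Cov G (W \ C) := by
      refine ih _ (sdiff_ssubset hC.subset ⟨x, hxC⟩) fun D hD => h D ?_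
      refine hD.of_closed sdiff_subset fun a ha b hb hab => mem_sdiff.2 ⟨hb, fun hbC => ?_⟩
      exact (mem_sdiff.1 (hD.subset ha)).2
        (hC.closed b hbC a (mem_sdiff.1 (hD.subset ha)).1 hab.symm)
    rw [← union_sdiff_of_subset hC.subset]
    exact (h C hC).union h1 disjoint_sdiff

/-- The sets that behave like the suns of Kaneko's theorem. -/
def Sun {V : Type*} [DecidableEq V] (G : SimpleGraph V) (C : Finset V) : Prop :=
  ∀ v ∈ C, Root G C v ∧ (Leaf G C v ∨ Leafed G C v)

open Classical in
/-- The sun components of the subgraph induced by `W`. -/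
noncomputable def suns {V : Type*} [DecidableEq V] (G : SimpleGraph V) (W : Finset V) :
    Finset (Finset V) :=
  W.powerset.filter fun C => IsComp G W C ∧ Sun G C

variable [DecidableEq V]

theorem mem_suns {W C : Finset V} : C ∈ suns G W ↔ IsComp G W C ∧ Sun G C := by
  simp only [suns, mem_filter, mem_powerset]
  exact ⟨fun h => h.2, fun h => ⟨h.1.subset, h⟩⟩

theorem sun_singleton (v : V) : Sun G {v} := by
  intro x hx
  rw [mem_singleton] at hx
  subst hx
  exact ⟨.inl rfl, .inl fun a ha b hb _ _ => by simp_all⟩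

theorem singleton_mem_suns {W : Finset V} {v : V} (hv : v ∈ W) (h : ∀ b ∈ W, ¬ G.Adj v b) :
    {v} ∈ suns G W :=
  mem_suns.2 ⟨isComp_singleton hv h, sun_singleton v⟩

/-- `Cov G W` only depends on the subgraph induced by `W`. -/
theorem Cov.congr {H : SimpleGraph V} {W : Finset V} (hW : Cov G W)
    (h : ∀ a ∈ W, ∀ b ∈ W, G.Adj a b → H.Adj a b) : Cov H W := by
  induction hW with
  | empty => exact .empty
  | cons p W hp h3 hd _ ih =>
    refine .cons p W ⟨?_, hp.2⟩ h3 hd (ih fun a ha b hb => h a (by simp [ha]) b (by simp [hb]))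
    refine hp.1.imp_of_mem_imp ?_
    intro a b ha hb
    exact h a (by simp [ha]) b (by simp [hb])

theorem Sun.congr {H : SimpleGraph V} {C : Finset V} (hC : Sun G C)
    (h : ∀ a ∈ C, ∀ b ∈ C, (G.Adj a b ↔ H.Adj a b)) : Sun H C := by
  have hleaf : ∀ v ∈ C, Leaf G C v → Leaf H C v := fun v hv hl x hx y hy hvx hvy =>
    hl x hx y hy ((h v hv x hx).2 hvx) ((h v hv y hy).2 hvy)
  intro v hv
  obtain ⟨hr, hl⟩ := hC v hv
  refine ⟨hr.imp_right ?_, hl.imp (hleaf v hv) ?_⟩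
  · rintro ⟨w, hw, hvw, hc⟩
    refine ⟨w, hw, (h v hv w hw).1 hvw, hc.congr fun a ha b hb => (h a ?_ b ?_).1⟩
    · exact mem_of_mem_erase (mem_of_mem_erase ha)
    · exact mem_of_mem_erase (mem_of_mem_erase hb)
  · rintro ⟨w, hw, hvw, hlw⟩
    exact ⟨w, hw, (h v hv w hw).1 hvw, hleaf w hw hlw⟩

end Components

end PathCover

/-! ### Extremal sets and assignments of suns to their vertices -/

namespace PathCover

open Finset

variable {V : Type*} [DecidableEq V] {G : SimpleGraph V}

/-- Kaneko's condition for nonempty sets `S`. -/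
def SunBound {V : Type*} [DecidableEq V] (G : SimpleGraph V) (W : Finset V) : Prop :=
  ∀ S ⊆ W, S.Nonempty → (suns G (W \ S)).card ≤ 2 * S.card

/-- A connected set that satisfies `SunBound` is coverable or a sun. -/
def Dichotomy {V : Type*} [DecidableEq V] (G : SimpleGraph V) (W : Finset V) : Prop :=
  Conn G W → SunBound G W → Cov G W ∨ Sun G W

theorem suns_anti {W W' C : Finset V} (hC : C ∈ suns G W) (hW : W' ⊆ W) (hCW : C ⊆ W') :
    C ∈ suns G W' :=
  mem_suns.2 ⟨(mem_suns.1 hC).1.anti hW hCW, (mem_suns.1 hC).2⟩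

theorem suns_of_closed {W D C : Finset V} (hC : C ∈ suns G D) (hDW : D ⊆ W)
    (hD : ∀ a ∈ C, ∀ b ∈ W, G.Adj a b → b ∈ D) : C ∈ suns G W :=
  mem_suns.2 ⟨(mem_suns.1 hC).1.of_closed hDW hD, (mem_suns.1 hC).2⟩

theorem suns_sdiff_subset {W D X : Finset V} (hDW : D ⊆ W)
    (hD : ∀ a ∈ D, ∀ b ∈ W, G.Adj a b → b ∈ D) : suns G (D \ X) ⊆ suns G (W \ X) := by
  intro E hE
  refine suns_of_closed hE (sdiff_subset_sdiff hDW subset_rfl) fun a ha b hb hab => ?_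
  have haD := (mem_suns.1 hE).1.subset ha
  rw [mem_sdiff] at haD hb ⊢
  exact ⟨hD a haD.1 b hb.1 hab, hb.2⟩

/-- The case `S = ∅` says that no component is a sun, which leaves only the first alternative of
`Dichotomy`. -/
theorem cov_of_card_suns_le {W : Finset V} (hIH : ∀ D ⊆ W, Dichotomy G D)
    (h : ∀ S ⊆ W, (suns G (W \ S)).card ≤ 2 * S.card) : Cov G W := by
  refine Cov.of_components fun C hC => ?_
  refine (hIH C hC.subset hC.conn fun X hX _ => ?_).resolve_right fun hs => ?_
  · exact (card_le_card (suns_sdiff_subset hC.subset hC.closed)).trans (h X (hX.trans hC.subset))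
  · have := h ∅ (empty_subset _)
    rw [sdiff_empty, card_empty, mul_zero, Nat.le_zero, card_eq_zero] at this
    have h2 : C ∈ suns G W := mem_suns.2 ⟨hC, hs⟩
    simp [this] at h2

/-- Suns of `D \ X` come on top of those of `W \ S`. Equality at `S` and the bound at `S ∪ X`
therefore allow at most `2|X|` of them, so `D` inherits `SunBound`. The slack `k` is 0 for tight and
1 for near-tight sets. -/
theorem cov_of_not_sun {W S : Finset V} (hIH : ∀ D ⊂ W, Dichotomy G D) (hSW : S ⊆ W)
    (hS : S.Nonempty) {k : ℕ}
    (hk : ∀ T ⊆ W, T.Nonempty → (suns G (W \ T)).card + k ≤ 2 * T.card)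
    (heq : (suns G (W \ S)).card + k = 2 * S.card) {D : Finset V} (hD : IsComp G (W \ S) D)
    (hns : ¬ Sun G D) : Cov G D := by
  have hDW : D ⊆ W := hD.subset.trans sdiff_subset
  have hss : D ⊂ W := by
    refine lt_of_le_of_ne hDW fun h => ?_
    obtain ⟨s, hs⟩ := hS
    exact (mem_sdiff.1 (hD.subset (h ▸ hSW hs))).2 hs
  refine (hIH D hss hD.conn fun X hX hXne => ?_).resolve_right hns
  have hXS : Disjoint S X := disjoint_left.2 fun x hxS hxX =>
    (mem_sdiff.1 (hD.subset (hX hxX))).2 hxS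
  have h1 : suns G (W \ S) ⊆ suns G (W \ (S ∪ X)) := by
    intro E hE
    have hEc := (mem_suns.1 hE).1
    have hED : Disjoint E D := hEc.disjoint hD fun h => hns (h ▸ (mem_suns.1 hE).2)
    refine suns_anti hE (sdiff_subset_sdiff subset_rfl subset_union_left) fun x hx => ?_
    have := mem_sdiff.1 (hEc.subset hx)
    rw [mem_sdiff, mem_union]
    exact ⟨this.1, fun h => h.elim this.2 fun hxX => disjoint_left.1 hED hx (hX hxX)⟩
  have h2 : suns G (D \ X) ⊆ suns G (W \ (S ∪ X)) := by
    have := suns_sdiff_subset (X := X) hD.subset hD.closed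
    convert this using 2
    ext x
    simp
    tauto
  have h3 : Disjoint (suns G (W \ S)) (suns G (D \ X)) := by
    rw [disjoint_left]
    intro E hE hE'
    obtain ⟨x, hx⟩ := (mem_suns.1 hE).1.conn.1
    have hxD : x ∈ D := (mem_sdiff.1 ((mem_suns.1 hE').1.subset hx)).1
    exact hns ((mem_suns.1 hE).1.eq_of_mem hD hx hxD ▸ (mem_suns.1 hE).2)
  have h4 := card_le_card (union_subset h1 h2)
  rw [card_union_of_disjoint h3] at h4
  have h5 := hk (S ∪ X) (union_subset hSW (hX.trans hDW)) (hS.mono subset_union_left)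
  rw [card_union_of_disjoint hXS] at h5
  omega

/-- `f` assigns each sun component of `W \ S` to one of its neighbours in `S`. -/
def Assign {V : Type*} [DecidableEq V] (G : SimpleGraph V) (W S : Finset V)
    (f : Finset V → V) : Prop :=
  ∀ C ∈ suns G (W \ S), f C ∈ S ∧ ∃ z ∈ C, G.Adj (f C) z

/-- The vertex `s` together with the sun components assigned to it. -/
noncomputable def piece {V : Type*} [DecidableEq V] (G : SimpleGraph V) (W S : Finset V)
    (f : Finset V → V) (s : V) : Finset V :=
  insert s (((suns G (W \ S)).filter (f · = s)).biUnion id)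

theorem mem_piece {W S : Finset V} {f : Finset V → V} {s x : V} :
    x ∈ piece G W S f s ↔ x = s ∨ ∃ C ∈ suns G (W \ S), f C = s ∧ x ∈ C := by
  simp [piece, and_assoc]

theorem suns_disjoint {W C D : Finset V} (hC : C ∈ suns G W) (hD : D ∈ suns G W) (h : C ≠ D) :
    Disjoint C D :=
  (mem_suns.1 hC).1.disjoint (mem_suns.1 hD).1 h

theorem notMem_of_mem_suns {W S C : Finset V} (hC : C ∈ suns G (W \ S)) {x : V} (hx : x ∈ S) :
    x ∉ C :=
  fun hxC => (mem_sdiff.1 ((mem_suns.1 hC).1.subset hxC)).2 hx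

theorem root_of_mem_suns {W C : Finset V} (hC : C ∈ suns G W) {x : V} (hx : x ∈ C) :
    Root G C x :=
  ((mem_suns.1 hC).2 x hx).1

/-- The pieces are disjoint, and what they miss consists of non-sun components. The set `T` lets
some pieces be covered jointly. -/
theorem Assign.cov {W S : Finset V} (hSW : S ⊆ W) {f : Finset V → V} (hf : Assign G W S f)
    (hns : ∀ D, IsComp G (W \ S) D → ¬ Sun G D → Cov G D) {T : Finset V} (hTS : T ⊆ S)
    (hT : Cov G (T.biUnion (piece G W S f)))
    (h : ∀ s ∈ S, s ∉ T → Cov G (piece G W S f s)) : Cov G W := by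
  have hdisj : ∀ s ∈ S, ∀ t ∈ S, s ≠ t → Disjoint (piece G W S f s) (piece G W S f t) := by
    intro s hs t ht hst
    rw [disjoint_left]
    intro x hx hx'
    rw [mem_piece] at hx hx'
    rcases hx with rfl | ⟨C, hC, rfl, hxC⟩
    · rcases hx' with rfl | ⟨C', hC', -, hxC'⟩
      · exact hst rfl
      · exact notMem_of_mem_suns hC' hs hxC'
    · rcases hx' with rfl | ⟨C', hC', rfl, hxC'⟩
      · exact notMem_of_mem_suns hC ht hxC
      · exact disjoint_left.1 (suns_disjoint hC hC' fun h => hst (h ▸ rfl)) hxC hxC'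
  have h1 : Cov G (S.biUnion (piece G W S f)) := by
    have hu : S.biUnion (piece G W S f) =
        T.biUnion (piece G W S f) ∪ (S \ T).biUnion (piece G W S f) := by
      rw [← union_biUnion, union_sdiff_of_subset hTS]
    rw [hu]
    refine hT.union (Cov.biUnion (fun s hs => h s (mem_sdiff.1 hs).1 (mem_sdiff.1 hs).2)
      fun s hs t ht => hdisj s (mem_sdiff.1 hs).1 t (mem_sdiff.1 ht).1) ?_
    rw [disjoint_biUnion_left]
    intro s hs
    rw [disjoint_biUnion_right]
    intro t ht
    exact hdisj s (hTS hs) t (mem_sdiff.1 ht).1 fun h => (mem_sdiff.1 ht).2 (h ▸ hs)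
  have hsub : S.biUnion (piece G W S f) ⊆ W := by
    intro x hx
    obtain ⟨s, hs, hx⟩ := mem_biUnion.1 hx
    rcases mem_piece.1 hx with rfl | ⟨C, hC, -, hxC⟩
    · exact hSW hs
    · exact (mem_sdiff.1 ((mem_suns.1 hC).1.subset hxC)).1
  have hS : S ⊆ S.biUnion (piece G W S f) := fun s hs =>
    mem_biUnion.2 ⟨s, hs, mem_piece.2 (.inl rfl)⟩
  have hsun : ∀ C ∈ suns G (W \ S), C ⊆ S.biUnion (piece G W S f) := fun C hC x hx =>
    mem_biUnion.2 ⟨f C, (hf C hC).1, mem_piece.2 (.inr ⟨C, hC, rfl, hx⟩)⟩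
  suffices h : Cov G (S.biUnion (piece G W S f) ∪ W \ S.biUnion (piece G W S f)) by
    rwa [union_sdiff_of_subset hsub] at h
  refine h1.union (Cov.of_components fun E hE => ?_) disjoint_sdiff
  have hEc : IsComp G (W \ S) E := by
    refine hE.of_closed (sdiff_subset_sdiff subset_rfl hS) fun a ha b hb hab => ?_
    have haE := mem_sdiff.1 (hE.subset ha)
    refine mem_sdiff.2 ⟨(mem_sdiff.1 hb).1, fun hbA => haE.2 ?_⟩
    obtain ⟨s, hs, hbs⟩ := mem_biUnion.1 hbA
    rcases mem_piece.1 hbs with rfl | ⟨C, hC, -, hbC⟩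
    · exact absurd hs (mem_sdiff.1 hb).2
    · refine hsun C hC ((mem_suns.1 hC).1.closed b hbC a ?_ hab.symm)
      exact mem_sdiff.2 ⟨haE.1, fun haS => haE.2 (hS haS)⟩
  refine hns E hEc fun hs => ?_
  obtain ⟨x, hx⟩ := hE.conn.1
  exact (mem_sdiff.1 (hE.subset hx)).2 (hsun E (mem_suns.2 ⟨hEc, hs⟩) hx)

theorem Assign.cov_piece_of_card_eq_two {W S : Finset V} {f : Finset V → V}
    (hf : Assign G W S f) {s : V} (hs : s ∈ S)
    (h : ((suns G (W \ S)).filter (f · = s)).card = 2) : Cov G (piece G W S f s) := by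
  obtain ⟨C₁, C₂, hne, hC⟩ := card_eq_two.1 h
  have hm : ∀ C, C ∈ suns G (W \ S) ∧ f C = s ↔ C = C₁ ∨ C = C₂ := fun C => by
    rw [← mem_filter (p := (f · = s)), hC]; simp
  obtain ⟨h₁, rfl⟩ := (hm C₁).2 (.inl rfl)
  obtain ⟨h₂, h₂s⟩ := (hm C₂).2 (.inr rfl)
  obtain ⟨z₁, hz₁, ha₁⟩ := (hf C₁ h₁).2
  obtain ⟨z₂, hz₂, ha₂⟩ := (hf C₂ h₂).2
  rw [h₂s] at ha₂
  refine (root_of_mem_suns h₁ hz₁).join_both hz₁ hz₂ (root_of_mem_suns h₂ hz₂)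
    (suns_disjoint h₁ h₂ hne) (isPathList_singleton (f C₁)) ⟨[], rfl⟩ ha₁.symm ha₂
    (by simpa using notMem_of_mem_suns h₁ hs) (by simpa using notMem_of_mem_suns h₂ hs) ?_
  intro x
  rw [piece, hC]
  simp

theorem Assign.cov_piece_of_eq_singleton {W S : Finset V} {f : Finset V → V}
    (hf : Assign G W S f) {s : V} (hs : s ∈ S) {C : Finset V} (hcard : 2 ≤ C.card)
    (h : (suns G (W \ S)).filter (f · = s) = {C}) : Cov G (piece G W S f s) := by
  obtain ⟨hC, rfl⟩ := mem_filter.1 (h ▸ mem_singleton_self C)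
  obtain ⟨z, hz, ha⟩ := (hf C hC).2
  refine (root_of_mem_suns hC hz).join_left hz (l := []) (isPathList_singleton (f C)) ha
    (by simpa using notMem_of_mem_suns hC hs) (.inr hcard) ?_
  intro x
  rw [piece, h]
  simp

/-- Only the pieces of `s` and `f C` need joint treatment; `C₁` is the second sun held by `f C`. -/
theorem Assign.cov_of_merge {W S : Finset V} (hSW : S ⊆ W) {f : Finset V → V}
    (hf : Assign G W S f) (hns : ∀ D, IsComp G (W \ S) D → ¬ Sun G D → Cov G D)
    {s : V} (hs : s ∈ S) {C₀ C : Finset V} (h₀ : (suns G (W \ S)).filter (f · = s) = {C₀})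
    (h2 : ∀ t ∈ S, t ≠ s → ((suns G (W \ S)).filter (f · = t)).card = 2)
    (hC : C ∈ suns G (W \ S)) (hne : f C ≠ s)
    (hm : ∀ C₁ ∈ suns G (W \ S), C₁ ≠ C → C₁ ≠ C₀ → f C₁ = f C → ∀ T : Finset V,
      (∀ x, x ∈ T ↔ (x = s ∨ x = f C) ∨ x ∈ C₀ ∨ x ∈ C ∨ x ∈ C₁) → Cov G T) : Cov G W := by
  have hcard := h2 (f C) (hf C hC).1 hne
  obtain ⟨C₁, hC₁, hC₁C⟩ := exists_mem_ne (hcard ▸ one_lt_two) C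
  rw [mem_filter] at hC₁
  have hfib : (suns G (W \ S)).filter (f · = f C) = {C, C₁} := by
    refine (eq_of_subset_of_card_le ?_ ?_).symm
    · intro E hE
      rw [mem_insert, mem_singleton] at hE
      rcases hE with rfl | rfl
      · simp [hC]
      · simp [hC₁]
    · rw [hcard, card_pair hC₁C.symm]
  have hC₀ : f C₀ = s := by
    have h : C₀ ∈ (suns G (W \ S)).filter (f · = s) := by rw [h₀, mem_singleton]
    exact (mem_filter.1 h).2
  refine hf.cov hSW hns (T := {s, f C}) ?_ ?_ fun t ht htT =>
    hf.cov_piece_of_card_eq_two ht (h2 t ht fun h => htT (by simp [h]))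
  · intro x hx
    rw [mem_insert, mem_singleton] at hx
    rcases hx with rfl | rfl
    · exact hs
    · exact (hf C hC).1
  · refine hm C₁ hC₁.1 hC₁C (fun h => hne ?_) hC₁.2 _ fun x => ?_
    · rw [← hC₁.2, h, hC₀]
    · rw [biUnion_insert, singleton_biUnion, piece, piece, h₀, hfib]
      simp
      tauto

end PathCover

/-! ### Tight and near-tight sets -/

namespace PathCover

open Finset

variable {V : Type*} [DecidableEq V] {G : SimpleGraph V}

open Classical in
/-- The vertices of `S` with a neighbour in `C`. -/
noncomputable def nbrs {V : Type*} (G : SimpleGraph V) (S C : Finset V) : Finset V :=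
  S.filter fun s => ∃ z ∈ C, G.Adj s z

omit [DecidableEq V] in
theorem mem_nbrs {S C : Finset V} {s : V} : s ∈ nbrs G S C ↔ s ∈ S ∧ ∃ z ∈ C, G.Adj s z := by
  simp [nbrs]

omit [DecidableEq V] in
theorem nbrs_subset {S C : Finset V} : nbrs G S C ⊆ S := fun _ hs => (mem_nbrs.1 hs).1

theorem nbrs_nonempty {W S C : Finset V} (hW : Conn G W) (hSW : S ⊆ W) (hS : S.Nonempty)
    (hC : IsComp G (W \ S) C) : (nbrs G S C).Nonempty := by
  obtain ⟨s, hs⟩ := hS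
  obtain ⟨a, ha, b, hb, hbC, hab⟩ := hW.2 C (hC.subset.trans sdiff_subset) hC.conn.1
    fun h => (mem_sdiff.1 (hC.subset (h ▸ hSW hs))).2 hs
  refine ⟨b, mem_nbrs.2 ⟨?_, a, ha, hab.symm⟩⟩
  by_contra hbS
  exact hbC (hC.closed a ha b (mem_sdiff.2 ⟨hb, hbS⟩) hab)

/-- Delete only the neighbours of `A` in `S`: the members of `A` are still sun components, so the
bound at that smaller set applies. -/
theorem card_add_le_of_subset_suns {W S : Finset V} (hW : Conn G W) (hSW : S ⊆ W)
    (hS : S.Nonempty) {k : ℕ}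
    (hk : ∀ T ⊆ W, T.Nonempty → (suns G (W \ T)).card + k ≤ 2 * T.card) {A : Finset (Finset V)}
    (hA : A ⊆ suns G (W \ S)) (hne : A.Nonempty) :
    A.card + k ≤ 2 * (A.biUnion (nbrs G S)).card := by
  have hX : A.biUnion (nbrs G S) ⊆ S := biUnion_subset.2 fun C _ => nbrs_subset
  have hXne : (A.biUnion (nbrs G S)).Nonempty := by
    obtain ⟨C, hC⟩ := hne
    obtain ⟨s, hs⟩ := nbrs_nonempty hW hSW hS (mem_suns.1 (hA hC)).1
    exact ⟨s, mem_biUnion.2 ⟨C, hC, hs⟩⟩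
  refine le_trans ?_ (hk _ (hX.trans hSW) hXne)
  gcongr
  intro C hC
  refine suns_of_closed (hA hC) (sdiff_subset_sdiff subset_rfl hX) fun a ha b hb hab => ?_
  rw [mem_sdiff] at hb ⊢
  refine ⟨hb.1, fun hbS => hb.2 ?_⟩
  exact mem_biUnion.2 ⟨C, hC, mem_nbrs.2 ⟨hbS, a, ha, hab.symm⟩⟩

theorem sum_capacity_add {α : Type*} [DecidableEq α] (X P : Finset α) :
    ∑ s ∈ X, (if s ∈ P then 1 else 2) + (X ∩ P).card = 2 * X.card := by
  have : (X ∩ P).card = ∑ s ∈ X, if s ∈ P then 1 else 0 := by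
    rw [sum_boole, filter_mem_eq_inter, Nat.cast_id]
  rw [this, ← sum_add_distrib, mul_comm, ← smul_eq_mul, ← sum_const]
  refine sum_congr rfl fun s _ => ?_
  split_ifs <;> rfl

/-- Hall's theorem for assigning two components to each vertex of `S \ P`, one to those of `P`. -/
theorem exists_assignment_of_suns {S P : Finset V} (hS : S.Nonempty) (hPS : P ⊆ S)
    {I : Finset (Finset V)} (hI : I.card + P.card = 2 * S.card)
    (h : ∀ A ⊆ I, A.Nonempty → A.card + (A.biUnion (nbrs G S) ∩ P).card ≤
      2 * (A.biUnion (nbrs G S)).card) :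
    ∃ f : Finset V → V, (∀ C ∈ I, f C ∈ S ∧ ∃ z ∈ C, G.Adj (f C) z) ∧
      ∀ s ∈ S, (I.filter (f · = s)).card = if s ∈ P then 1 else 2 := by
  have : Nonempty V := ⟨hS.choose⟩
  obtain ⟨f, hf, hc⟩ := exists_exact_assignment I S (nbrs G S) (fun s => if s ∈ P then 1 else 2)
    (fun C _ => nbrs_subset)
    (by
      have := sum_capacity_add S P
      rw [inter_eq_right.2 hPS] at this
      omega)
    (fun A hA => by
      rcases A.eq_empty_or_nonempty with rfl | hne
      · simp
      have := sum_capacity_add (A.biUnion (nbrs G S)) P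
      have := h A hA hne
      omega)
  exact ⟨f, fun C hC => mem_nbrs.1 (hf C hC), hc⟩

theorem cov_of_tight {W : Finset V} (hW : Conn G W) (hIH : ∀ D ⊂ W, Dichotomy G D)
    (hb : SunBound G W) {S : Finset V} (hSW : S ⊆ W) (hS : S.Nonempty)
    (heq : (suns G (W \ S)).card = 2 * S.card) : Cov G W := by
  obtain ⟨f, hf, hc⟩ := exists_assignment_of_suns (G := G) (P := ∅) hS (empty_subset _)
    (by simpa using heq) (fun A hA hne => by
      simpa using card_add_le_of_subset_suns (k := 0) hW hSW hS hb hA hne)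
  refine Assign.cov hSW hf (fun D hD hns => cov_of_not_sun (k := 0) hIH hSW hS hb heq hD hns)
    (empty_subset _) (by simpa using Cov.empty) fun s hs _ => ?_
  exact Assign.cov_piece_of_card_eq_two hf hs (by simpa using hc s hs)

/-- The vertex `v` serves as a bridge: one path runs through `C₀`, `s`, `v`, `f {v}`, `C₁`. -/
theorem Assign.cov_of_singleton {W S : Finset V} (hSW : S ⊆ W) {f : Finset V → V}
    (hf : Assign G W S f) (hns : ∀ D, IsComp G (W \ S) D → ¬ Sun G D → Cov G D)
    {s v : V} (hs : s ∈ S) (h₀ : ((suns G (W \ S)).filter (f · = s)).card = 1)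
    (h2 : ∀ t ∈ S, t ≠ s → ((suns G (W \ S)).filter (f · = t)).card = 2)
    (hv : {v} ∈ suns G (W \ S)) (hne : f {v} ≠ s) (hsv : G.Adj s v) : Cov G W := by
  obtain ⟨C₀, h₀⟩ := card_eq_one.1 h₀
  have hC₀ : C₀ ∈ (suns G (W \ S)).filter (f · = s) := by rw [h₀, mem_singleton]
  rw [mem_filter] at hC₀
  refine hf.cov_of_merge hSW hns hs h₀ h2 hv hne fun C₁ hC₁ hC₁v hC₁₀ hC₁f T hT => ?_
  obtain ⟨z₀, hz₀, ha₀⟩ := (hf C₀ hC₀.1).2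
  obtain ⟨z₁, hz₁, ha₁⟩ := (hf C₁ hC₁).2
  obtain ⟨w, hw, ha⟩ := (hf {v} hv).2
  rw [mem_singleton] at hw
  subst hw
  rw [hC₀.2] at ha₀
  rw [hC₁f] at ha₁
  have hfS := (hf {w} hv).1
  have hd₀ : Disjoint C₀ {w} := suns_disjoint hC₀.1 hv fun h => hne (h ▸ hC₀.2)
  have hd₁ : Disjoint C₁ {w} := suns_disjoint hC₁ hv hC₁v
  rw [disjoint_singleton_right] at hd₀ hd₁
  have hws : ∀ t ∈ S, t ≠ w := fun t ht h => notMem_of_mem_suns hv ht (by simp [h])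
  refine (root_of_mem_suns hC₀.1 hz₀).join_both hz₀ hz₁ (root_of_mem_suns hC₁ hz₁)
    (suns_disjoint hC₀.1 hC₁ hC₁₀.symm) (b := s) (l := [w, f {w}]) (a := f {w}) ?_ ⟨[s, w], rfl⟩
    ha₀.symm ha₁ ?_ ?_ ?_
  · rw [isPathList_cons_cons, isPathList_cons_cons]
    refine ⟨hsv, ?_, ha.symm, ?_, isPathList_singleton _⟩
    · simp [hws s hs, hne.symm]
    · simp [(hws _ hfS).symm]
  · simp [hd₀, notMem_of_mem_suns hC₀.1 hs, notMem_of_mem_suns hC₀.1 hfS]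
  · simp [hd₁, notMem_of_mem_suns hC₁ hs, notMem_of_mem_suns hC₁ hfS]
  · intro x
    rw [hT]
    simp
    tauto

/-- Give one sun to `s` and two to every other vertex of `S`. If the sun at `s` had two vertices,
every piece would be coverable, so it is some `{v}`. A second neighbour `s₁` of `v` would lie in
`S`, and moving `{v}` to `s₁` would give a cover by `Assign.cov_of_singleton`. -/
theorem exists_assignment_of_near_tight {W : Finset V} (hW : Conn G W)
    (hIH : ∀ D ⊂ W, Dichotomy G D)
    (hb : ∀ S ⊆ W, S.Nonempty → (suns G (W \ S)).card + 1 ≤ 2 * S.card) (hcov : ¬ Cov G W)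
    {S : Finset V} (hSW : S ⊆ W) (heq : (suns G (W \ S)).card + 1 = 2 * S.card) {s : V}
    (hs : s ∈ S) : ∃ f v, Assign G W S f ∧ (suns G (W \ S)).filter (f · = s) = {{v}} ∧
      (∀ t ∈ S, t ≠ s → ((suns G (W \ S)).filter (f · = t)).card = 2) ∧
      v ∈ W ∧ G.Adj s v ∧ ∀ x ∈ W, G.Adj v x → x = s := by
  have hS : S.Nonempty := ⟨s, hs⟩
  have hns : ∀ D, IsComp G (W \ S) D → ¬ Sun G D → Cov G D := fun D hD hns =>
    cov_of_not_sun (k := 1) hIH hSW hS hb heq hD hns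
  have hle : ∀ A ⊆ suns G (W \ S), A.Nonempty → A.card + 1 ≤ 2 * (A.biUnion (nbrs G S)).card :=
    fun A hA hne => card_add_le_of_subset_suns hW hSW hS hb hA hne
  obtain ⟨f, hf, hc⟩ := exists_assignment_of_suns (G := G) (P := {s}) hS (by simpa using hs)
    (by simpa using heq) (fun A hA hne => by
      have h1 := hle A hA hne
      have h2 : (A.biUnion (nbrs G S) ∩ {s}).card ≤ 1 :=
        (card_le_card inter_subset_right).trans (by simp)
      omega)
  have hf : Assign G W S f := hf
  have h0 : ((suns G (W \ S)).filter (f · = s)).card = 1 := by simpa using hc s hs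
  have h2 : ∀ t ∈ S, t ≠ s → ((suns G (W \ S)).filter (f · = t)).card = 2 := fun t ht hts => by
    simpa [hts] using hc t ht
  obtain ⟨C, hC⟩ := card_eq_one.1 h0
  have hCm : C ∈ (suns G (W \ S)).filter (f · = s) := by rw [hC, mem_singleton]
  rw [mem_filter] at hCm
  obtain ⟨hCs, hCf⟩ := hCm
  have hCcard : C.card ≤ 1 := by
    by_contra hlt
    refine hcov (hf.cov hSW hns (T := ∅) (empty_subset _) (by simpa using Cov.empty)
      fun t ht _ => ?_)
    by_cases hts : t = s
    · subst hts
      exact hf.cov_piece_of_eq_singleton ht (by omega) hC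
    · exact hf.cov_piece_of_card_eq_two ht (h2 t ht hts)
  obtain ⟨v, rfl⟩ : ∃ v, C = {v} := card_eq_one.1 <|
    le_antisymm hCcard (card_pos.2 (mem_suns.1 hCs).1.conn.1)
  have hsv : G.Adj s v := by
    obtain ⟨z, hz, ha⟩ := (hf {v} hCs).2
    rw [mem_singleton] at hz
    rwa [hz, hCf] at ha
  have hvW := mem_sdiff.1 ((mem_suns.1 hCs).1.subset (mem_singleton_self v))
  refine ⟨f, v, hf, hC, h2, hvW.1, hsv, fun s₁ hs₁W hvs₁ => ?_⟩
  by_contra hne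
  have hs₁ : s₁ ∈ S := by
    by_contra hs₁
    have := (mem_suns.1 hCs).1.closed v (mem_singleton_self v) s₁ (mem_sdiff.2 ⟨hs₁W, hs₁⟩) hvs₁
    rw [mem_singleton] at this
    exact hvs₁.ne this.symm
  have hcard : ((suns G (W \ S)).erase {v}).card + 1 = (suns G (W \ S)).card :=
    card_erase_add_one hCs
  -- The suns other than `{v}` are redistributed; one place at `s₁` is kept free for `{v}`.
  obtain ⟨g, hg, hgc⟩ := exists_assignment_of_suns (G := G) (P := {s, s₁}) hS
    (I := (suns G (W \ S)).erase {v}) (by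
      intro x hx
      rw [mem_insert, mem_singleton] at hx
      rcases hx with rfl | rfl <;> assumption)
    (by rw [card_pair (Ne.symm hne)]; omega) (fun A hA hAne => by
      have hA' : A ⊆ suns G (W \ S) := hA.trans (erase_subset _ _)
      set X := A.biUnion (nbrs G S) with hX
      have hP : (X ∩ {s, s₁}).card ≤ 2 :=
        (card_le_card inter_subset_right).trans card_le_two
      -- If `s ∈ X`, then `f` maps `A` into `X.erase s` at most two to one, since only `{v}` went to
      -- `s`; this gives slack two. Otherwise slack one suffices.
      by_cases hsX : s ∈ X
      · have h3 : A.card ≤ 2 * (X.erase s).card := by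
          have hmap : ∀ C ∈ A, f C ∈ X.erase s := by
            intro C hC'
            refine mem_erase.2 ⟨fun h => ?_, ?_⟩
            · have : C ∈ (suns G (W \ S)).filter (f · = s) := mem_filter.2 ⟨hA' hC', h⟩
              rw [hC, mem_singleton] at this
              exact (mem_erase.1 (hA hC')).1 this
            · exact mem_biUnion.2 ⟨C, hC', mem_nbrs.2 (hf C (hA' hC'))⟩
          refine card_le_mul_card_image_of_maps_to hmap 2 fun t ht => ?_
          have htS : t ∈ S := (biUnion_subset.2 fun C _ => nbrs_subset : X ⊆ S)
            (mem_erase.1 ht).2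
          rw [← h2 t htS (mem_erase.1 ht).1]
          exact card_le_card (filter_subset_filter _ hA')
        have := card_erase_add_one hsX
        omega
      · have h3 : (X ∩ {s, s₁}).card ≤ 1 := by
          rw [inter_insert_of_notMem hsX]
          exact (card_le_card inter_subset_right).trans (by simp)
        have : A.card + 1 ≤ 2 * X.card := hle A hA' hAne
        omega)
  let g' : Finset V → V := fun C => if C = {v} then s₁ else g C
  have hg' : Assign G W S g' := by
    intro C hC'
    by_cases h : C = {v}
    · simp only [g', h, if_true]
      exact ⟨hs₁, v, by simp, hvs₁.symm⟩
    · simp only [g', h, if_false]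
      exact hg C (mem_erase.2 ⟨h, hC'⟩)
  have hfilt : ∀ t, t ≠ s₁ → (suns G (W \ S)).filter (g' · = t) =
      ((suns G (W \ S)).erase {v}).filter (g · = t) := by
    intro t ht
    ext C
    by_cases h : C = {v}
    · simp [g', h, ht.symm]
    · simp [g', h]
  have hfilt₁ : (suns G (W \ S)).filter (g' · = s₁) =
      insert {v} (((suns G (W \ S)).erase {v}).filter (g · = s₁)) := by
    ext C
    by_cases h : C = {v}
    · simp [g', h, hCs]
    · simp [g', h]
  refine hcov (hg'.cov_of_singleton hSW hns hs ?_ ?_ hCs ?_ hsv)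
  · rw [hfilt s (Ne.symm hne), hgc s hs]
    simp
  · intro t ht hts
    by_cases hts₁ : t = s₁
    · subst hts₁
      rw [hfilt₁, card_insert_of_notMem (by simp), hgc t ht]
      simp
    · rw [hfilt t hts₁, hgc t ht]
      simp [hts, hts₁]
  · simp [g', hne]

theorem leafed_of_near_tight {W : Finset V} (hW : Conn G W) (hIH : ∀ D ⊂ W, Dichotomy G D)
    (hb : ∀ S ⊆ W, S.Nonempty → (suns G (W \ S)).card + 1 ≤ 2 * S.card) (hcov : ¬ Cov G W)
    {S : Finset V} (hSW : S ⊆ W) (hle : 2 * S.card ≤ (suns G (W \ S)).card + 1) {s : V}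
    (hs : s ∈ S) : ∃ v ∈ W, G.Adj s v ∧ ∀ x ∈ W, G.Adj v x → x = s := by
  obtain ⟨f, v, -, -, -, hv, hsv, h⟩ := exists_assignment_of_near_tight hW hIH hb hcov hSW
    (le_antisymm (hb S hSW ⟨s, hs⟩) hle) hs
  exact ⟨v, hv, hsv, h⟩

end PathCover

/-! ### Leaf edges, bridges and restoring an edge -/

namespace PathCover

open Finset

variable {V : Type*} [DecidableEq V] {G G' : SimpleGraph V}

omit [DecidableEq V] in
theorem Leaf.of_forall_eq {W : Finset V} {u x : V} (h : ∀ b ∈ W, G.Adj u b → b = x) :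
    Leaf G W u := fun a ha b hb hua hub => (h a ha hua).trans (h b hb hub).symm

omit [DecidableEq V] in
theorem Leaf.mono {W W' : Finset V} {u : V} (h : Leaf G W u) (hW : W' ⊆ W) : Leaf G W' u :=
  fun a ha b hb => h a (hW ha) b (hW hb)

theorem suns_of_graph {W W' C : Finset V} (hC : C ∈ suns G' W') (hW : W ⊆ W') (hCW : C ⊆ W)
    (h : ∀ a ∈ C, ∀ b ∈ W, (G.Adj a b ↔ G'.Adj a b)) : C ∈ suns G W := by
  obtain ⟨hc, hs⟩ := mem_suns.1 hC
  refine mem_suns.2 ⟨⟨hCW, hc.conn.congr fun a ha b hb => (h a ha b (hCW hb)).2,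
    fun a ha b hb hab => hc.closed a ha b (hW hb) ((h a ha b hb).1 hab)⟩,
    hs.congr fun a ha b hb => (h a ha b (hCW hb)).symm⟩

/-- Adding `v` to `X` allows two more suns; one is `{w}`, the other is the spare unit in `hb`. -/
theorem cov_erase_leaf {W : Finset V} (hIH : ∀ D ⊂ W, Dichotomy G D)
    (hb : ∀ S ⊆ W, S.Nonempty → (suns G (W \ S)).card + 1 ≤ 2 * S.card) {v w : V} (hv : v ∈ W)
    (hw : w ∈ W) (hvw : G.Adj v w) (hl : ∀ x ∈ W, G.Adj w x → x = v) :
    Cov G ((W.erase v).erase w) := by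
  refine cov_of_card_suns_le (fun D hD => hIH D ?_) fun X hX => ?_
  · exact lt_of_le_of_lt (hD.trans (erase_subset _ _)) (erase_ssubset hv)
  have hvX : v ∉ X := fun h => by simpa using hX h
  have hwX : w ∉ X := fun h => by simpa using hX h
  have hXW : X ⊆ W := hX.trans ((erase_subset _ _).trans (erase_subset _ _))
  have h1 : insert {w} (suns G ((W.erase v).erase w \ X)) ⊆ suns G (W \ insert v X) := by
    intro C hC
    rcases mem_insert.1 hC with rfl | hC
    · refine singleton_mem_suns ?_ fun b hbW hwb => ?_
      · simp [hw, hvw.ne', hwX]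
      · simp [hl b (mem_sdiff.1 hbW).1 hwb] at hbW
    · refine suns_of_closed hC (fun x hx => ?_) fun a ha b hb hab => ?_
      · simp at hx ⊢
        tauto
      · have ha' := (mem_suns.1 hC).1.subset ha
        have : b ≠ w := by
          rintro rfl
          have := hl a (by simp at ha'; tauto) hab.symm
          simp [this] at ha'
        simp at hb ⊢
        tauto
  have h2 := card_le_card h1
  rw [card_insert_of_notMem fun h => by
    have := (mem_suns.1 h).1.subset (mem_singleton_self w)
    simp at this] at h2
  have h3 := hb (insert v X) (insert_subset hv hXW) (insert_nonempty _ _)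
  rw [card_insert_of_notMem hvX] at h3
  omega

/-- A leaf edge at `v` serves as its root edge, by `cov_erase_leaf`. -/
theorem sun_of_forall_leaf_or_leafed {W : Finset V} (hW : Conn G W)
    (hIH : ∀ D ⊂ W, Dichotomy G D)
    (hb : ∀ S ⊆ W, S.Nonempty → (suns G (W \ S)).card + 1 ≤ 2 * S.card)
    (h : ∀ v ∈ W, Leaf G W v ∨ Leafed G W v) : Sun G W := by
  intro v hv
  refine ⟨?_, h v hv⟩
  by_cases hWv : W = {v}
  · exact .inl hWv
  right
  rcases h v hv with hl | ⟨w, hw, hvw, hl⟩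
  · obtain ⟨a, ha, w, hw, -, haw⟩ := hW.2 {v} (by simpa using hv) (singleton_nonempty v)
      (Ne.symm hWv)
    rw [mem_singleton] at ha
    subst ha
    refine ⟨w, hw, haw, ?_⟩
    rw [erase_right_comm]
    exact cov_erase_leaf hIH hb hw hv haw.symm fun x hx hax => hl x hx w hw hax haw
  · exact ⟨w, hw, hvw, cov_erase_leaf hIH hb hv hw hvw fun x hx hwx =>
      hl x hx v hv hwx hvw.symm⟩

/-- Edges leave `B` only at `z`, so all suns of `B \ X` except perhaps the one containing `z` are
suns of `W \ X`; the spare unit in `hb` pays for that one. -/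
theorem cov_of_side {W B : Finset V} (hW : Conn G W) (hIH : ∀ D ⊂ W, Dichotomy G D)
    (hb : ∀ S ⊆ W, S.Nonempty → (suns G (W \ S)).card + 1 ≤ 2 * S.card) (hB : B ⊂ W) {z : V}
    (hcl : ∀ a ∈ B, a ≠ z → ∀ b ∈ W, G.Adj a b → b ∈ B) (hz : ∀ C ∈ suns G B, z ∉ C) :
    Cov G B := by
  refine cov_of_card_suns_le (fun D hD => hIH D (lt_of_le_of_lt hD hB)) fun X hX => ?_
  have hsub : ∀ C ∈ suns G (B \ X), z ∉ C → C ∈ suns G (W \ X) := fun C hC hzC => by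
    refine suns_of_closed hC (sdiff_subset_sdiff hB.1 subset_rfl) fun a ha b hbW hab => ?_
    have haB := mem_sdiff.1 ((mem_suns.1 hC).1.subset ha)
    exact mem_sdiff.2 ⟨hcl a haB.1 (fun h => hzC (h ▸ ha)) b (mem_sdiff.1 hbW).1 hab,
      (mem_sdiff.1 hbW).2⟩
  rcases X.eq_empty_or_nonempty with rfl | hXne
  · rw [card_empty, mul_zero, Nat.le_zero, card_eq_zero, eq_empty_iff_forall_notMem]
    intro C hC
    have hzC : z ∉ C := hz C (by simpa using hC)
    have hCW := hW.eq_of_isComp (mem_suns.1 (by simpa using hsub C hC hzC)).1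
    exact hB.2 (hCW ▸ (mem_suns.1 hC).1.subset.trans sdiff_subset)
  · have h1 : ((suns G (B \ X)).filter (z ∉ ·)).card ≤ (suns G (W \ X)).card :=
      card_le_card fun C hC => hsub C (mem_filter.1 hC).1 (mem_filter.1 hC).2
    have h2 : ((suns G (B \ X)).filter (z ∈ ·)).card ≤ 1 := by
      refine card_le_one.2 fun C hC D hD => ?_
      rw [mem_filter] at hC hD
      exact (mem_suns.1 hC.1).1.eq_of_mem (mem_suns.1 hD.1).1 hC.2 hD.2
    have h3 := card_filter_add_card_filter_not (s := suns G (B \ X)) (z ∈ ·)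
    have h4 := hb X (hX.trans hB.1) hXne
    omega

/-- A sun of `A` through `x` would make `{y}` near-tight and `y` leafed. A sun of `W \ A` through
`y` would make `{x}` near-tight, and the leaf at `x` would be a second sun of `W \ {x}`, one too
many. -/
theorem cov_of_bridge {W A : Finset V} (hW : Conn G W) (hIH : ∀ D ⊂ W, Dichotomy G D)
    (hb : ∀ S ⊆ W, S.Nonempty → (suns G (W \ S)).card + 1 ≤ 2 * S.card) {x y : V}
    (hx : x ∈ A) (hy : y ∈ W) (hyA : y ∉ A) (hAW : A ⊆ W) (hyl : ¬ Leaf G W y)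
    (hyL : ¬ Leafed G W y)
    (hA : ∀ a ∈ A, ∀ b ∈ W, b ∉ A → G.Adj a b → a = x ∧ b = y) : Cov G W := by
  by_contra hcov
  have hxW := hAW hx
  have key : ∀ {s}, s ∈ W → ∀ {C}, C ∈ suns G (W \ {s}) →
      ∃ v ∈ W, G.Adj s v ∧ ∀ x ∈ W, G.Adj v x → x = s := fun {s} hs {C} hC => by
    have hpos : 0 < (suns G (W \ {s})).card := card_pos.2 ⟨C, hC⟩
    exact leafed_of_near_tight (S := {s}) hW hIH hb hcov (by simpa using hs)
      (by rw [card_singleton]; omega) (mem_singleton_self s)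
  have h1 : Cov G A := by
    refine cov_of_side hW hIH hb (z := x) ⟨hAW, fun h => hyA (h hy)⟩ ?_ ?_
    · intro a ha hax b hbW hab
      by_contra hbA
      exact hax (hA a ha b hbW hbA hab).1
    · intro C hC hxC
      have : C ∈ suns G (W \ {y}) := by
        refine suns_of_closed hC (fun a ha => ?_) fun a ha b hbW hab => ?_
        · rw [mem_sdiff, mem_singleton]
          exact ⟨hAW ha, fun h => hyA (h ▸ ha)⟩
        · rw [mem_sdiff, mem_singleton] at hbW
          by_contra hbA
          exact hbW.2 (hA a ((mem_suns.1 hC).1.subset ha) b hbW.1 hbA hab).2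
      obtain ⟨v, hv, hyv, hl⟩ := key hy this
      exact hyL ⟨v, hv, hyv, Leaf.of_forall_eq hl⟩
  have h2 : Cov G (W \ A) := by
    refine cov_of_side hW hIH hb (z := y) (sdiff_ssubset hAW ⟨x, hx⟩) ?_ ?_
    · intro a ha hay b hbW hab
      rw [mem_sdiff] at ha ⊢
      exact ⟨hbW, fun hbA => hay (hA b hbA a ha.1 ha.2 hab.symm).2⟩
    · intro C hC hyC
      have hCx : C ∈ suns G (W \ {x}) := by
        refine suns_of_closed hC (sdiff_subset_sdiff subset_rfl (by simpa using hx))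
          fun a ha b hbW hab => ?_
        rw [mem_sdiff, mem_singleton] at hbW
        have ha' := mem_sdiff.1 ((mem_suns.1 hC).1.subset ha)
        exact mem_sdiff.2 ⟨hbW.1, fun hbA => hbW.2 (hA b hbA a ha'.1 ha'.2 hab.symm).1⟩
      obtain ⟨u, hu, hxu, hl⟩ := key hxW hCx
      have hus : {u} ∈ suns G (W \ {x}) := by
        refine singleton_mem_suns ?_ fun b hbW hub => ?_
        · rw [mem_sdiff, mem_singleton]
          exact ⟨hu, hxu.ne'⟩
        · rw [mem_sdiff, mem_singleton] at hbW
          exact hbW.2 (hl b hbW.1 hub)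
      have hne : C ≠ {u} := by
        rintro rfl
        rw [mem_singleton] at hyC
        exact hyl (hyC ▸ Leaf.of_forall_eq hl)
      have h3 : ({C, {u}} : Finset (Finset V)).card ≤ (suns G (W \ {x})).card := by
        refine card_le_card ?_
        intro D hD
        rw [mem_insert, mem_singleton] at hD
        rcases hD with rfl | rfl <;> assumption
      rw [card_pair hne] at h3
      have := hb {x} (by simpa using hxW) (singleton_nonempty x)
      rw [card_singleton] at this
      omega
  refine hcov ?_
  rw [← union_sdiff_of_subset hAW]
  exact h1.union h2 disjoint_sdiff

/-- In `G'` the vertex `y` must be a leaf, hence an end of its covering path once the root edge `xa`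
is removed. The edge `xy` attaches `a, x` there. -/
theorem cov_of_sun_deleteEdge {W : Finset V} {x y : V} (hx : x ∈ W) (hy : y ∈ W)
    (hxy : G.Adj x y) (hyL : ¬ Leafed G W y)
    (hG' : ∀ a b, G'.Adj a b ↔ G.Adj a b ∧ ¬ (a = x ∧ b = y) ∧ ¬ (a = y ∧ b = x))
    (hs : Sun G' W) : Cov G W := by
  have hle : G' ≤ G := fun a b hab => ((hG' a b).1 hab).1
  have hl : Leaf G' W y := by
    refine (hs y hy).2.resolve_right fun ⟨w, hw, hyw, hl⟩ => hyL ⟨w, hw, hle hyw, ?_⟩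
    have hwx : w ≠ x := by
      rintro rfl
      simp [hG'] at hyw
    have hwy : w ≠ y := hyw.ne'
    intro a ha b hb hwa hwb
    exact hl a ha b hb ((hG' _ _).2 ⟨hwa, by simp [hwx], by simp [hwy]⟩)
      ((hG' _ _).2 ⟨hwb, by simp [hwx], by simp [hwy]⟩)
  rcases (hs x hx).1 with h | ⟨a, ha, hxa, hc⟩
  · simp [h] at hy
    exact absurd hy.symm hxy.ne
  have hay : a ≠ y := by
    rintro rfl
    simp [hG'] at hxa
  have hyC : y ∈ (W.erase x).erase a := by simp [hay.symm, hxy.ne', hy]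
  obtain ⟨p, hp, h3, hyp, hpW, hc'⟩ := hc.exists_path hyC
  have hpW' : ∀ b ∈ p, b ∈ W := fun b hb => mem_of_mem_erase (mem_of_mem_erase (hpW b hb))
  obtain ⟨q, hq, hqp, hlen⟩ := hl.exists_eq_cons hp hyp hpW'
  have hax : IsPathList G ([a] ++ [x]) := isPathList_cons_cons.2
    ⟨hle hxa.symm, by simpa using hxa.ne', isPathList_singleton x⟩
  have hpath := hax.append (hq.mono hle) hxy fun b hb hbq => by
    have := hpW b ((hqp b).1 hbq)
    simp at hb
    rcases hb with rfl | rfl <;> simp at this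
  refine Cov.of_path_union hpath (by simp) (hc'.mono hle) ?_ ?_
  · intro b hb
    rw [List.mem_append, hqp] at hb
    rcases hb with hb | hb
    · simp at hb
      rcases hb with rfl | rfl <;> simp
    · simp [hb]
  · intro b
    rw [List.mem_append, hqp]
    have := hpW' b
    simp
    by_cases h1 : b = a
    · simp [h1, ha]
    by_cases h2 : b = x
    · simp [h2, hx]
    tauto

end PathCover

/-! ### Edge deletion and the induction -/

namespace PathCover

open Finset

variable {V : Type*} [DecidableEq V] {G G' : SimpleGraph V}

/-- Suns of `G'` avoiding `x` and `y` are suns of `G`, so at least two contain `x` or `y`; being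
disjoint, they contain one each. -/
theorem exists_split_of_lt_card_suns {W S : Finset V} {x y : V} {n : ℕ}
    (hG' : ∀ a b, G'.Adj a b ↔ G.Adj a b ∧ ¬ (a = x ∧ b = y) ∧ ¬ (a = y ∧ b = x))
    (hb : (suns G (W \ S)).card + 1 ≤ n) (hlt : n + 1 ≤ (suns G' (W \ S)).card) :
    ∃ D₁ ∈ suns G' (W \ S), ∃ D₂ ∈ suns G' (W \ S), D₁ ≠ D₂ ∧ x ∈ D₁ ∧ y ∈ D₂ := by
  have h1 : ((suns G' (W \ S)).filter fun C => x ∉ C ∧ y ∉ C).card ≤ (suns G (W \ S)).card := by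
    refine card_le_card fun C hC => ?_
    obtain ⟨hC, hxC, hyC⟩ := mem_filter.1 hC
    refine suns_of_graph hC subset_rfl (mem_suns.1 hC).1.subset fun a ha b _ => ?_
    rw [hG']
    have : a ≠ x := fun h => hxC (h ▸ ha)
    have : a ≠ y := fun h => hyC (h ▸ ha)
    tauto
  have h2 := card_filter_add_card_filter_not (s := suns G' (W \ S)) fun C => x ∉ C ∧ y ∉ C
  obtain ⟨C, hC, D, hD, hne⟩ := one_lt_card.1
    (by omega : 1 < ((suns G' (W \ S)).filter fun C => ¬ (x ∉ C ∧ y ∉ C)).card)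
  rw [mem_filter] at hC hD
  have hCD := disjoint_left.1 (suns_disjoint hC.1 hD.1 hne)
  by_cases hxC : x ∈ C
  · have := hCD hxC
    exact ⟨C, hC.1, D, hD.1, hne, hxC, by tauto⟩
  · have : y ∈ C := by tauto
    have := hCD this
    exact ⟨D, hD.1, C, hC.1, hne.symm, by tauto, by tauto⟩

/-- The last step of the deletion argument: an assignment with respect to `S` in which `x` only
gets its leaf `u`, while the sun component `D` joined to `x` by the edge `xy` is assigned to
another vertex. -/
theorem Assign.cov_of_adj_leaf {W S : Finset V} (hSW : S ⊆ W) {f : Finset V → V}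
    (hf : Assign G W S f) (hns : ∀ D, IsComp G (W \ S) D → ¬ Sun G D → Cov G D)
    {x u y : V} (hx : x ∈ S) (h₀ : (suns G (W \ S)).filter (f · = x) = {{u}})
    (h2 : ∀ t ∈ S, t ≠ x → ((suns G (W \ S)).filter (f · = t)).card = 2) {D : Finset V}
    (hD : D ∈ suns G (W \ S)) (hne : f D ≠ x) (hxy : G.Adj x y) (hxu : G.Adj x u) (hy : y ∈ D)
    (hyl : Leaf G D y) (hDy : Cov G (D.erase y)) : Cov G W := by
  have hu : {u} ∈ (suns G (W \ S)).filter (f · = x) := by rw [h₀, mem_singleton]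
  rw [mem_filter] at hu
  refine hf.cov_of_merge hSW hns hx h₀ h2 hD hne fun C hC hCD hCu hCf T hT => ?_
  obtain ⟨htS, z, hz, htz⟩ := hf D hD
  obtain ⟨-, z₁, hz₁, htz₁⟩ := hf C hC
  rw [hCf] at htz₁
  have huD : u ∉ D := disjoint_singleton_left.1
    (suns_disjoint hu.1 hD fun h => hne (by rw [← h]; exact hu.2))
  have huC : u ∉ C := disjoint_singleton_left.1 (suns_disjoint hu.1 hC hCu.symm)
  have hux : u ≠ x := hxu.ne'
  have hut : u ≠ f D := fun h => notMem_of_mem_suns hu.1 htS (by simp [h])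
  have hxD := notMem_of_mem_suns hD hx
  have hxC := notMem_of_mem_suns hC hx
  have htD := notMem_of_mem_suns hD htS
  have htC := notMem_of_mem_suns hC htS
  have hDC := disjoint_left.1 (suns_disjoint hD hC hCD.symm)
  have hr := root_of_mem_suns hC hz₁
  have hrD := root_of_mem_suns hD hz
  generalize f D = t at *
  have hyx : y ≠ x := hxy.ne'
  have hyu : y ≠ u := fun h => huD (h ▸ hy)
  have hyt : y ≠ t := fun h => htD (h ▸ hy)
  -- Depending on how `t` meets `D`, the cover uses `u, x, y, t` into `C`, or `u, x, y, z, t` into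
  -- `C`, or `w, z, t` into `C` with `u, x` attached at the leaf `y` of the remainder of `D`.
  by_cases hty : G.Adj t y
  · have h1 : Cov G ({u, x, y, t} ∪ C) := by
      refine hr.join_left hz₁ (l := [u, x, y]) (a := t) ⟨?_, ?_⟩ htz₁ ?_ (.inl (by simp)) ?_
      · simp [hxu.symm, hxy, hty.symm]
      · simp [hux, hyu.symm, hut, hyx.symm, hne.symm, hyt]
      · simp [huC, hxC, htC, hDC hy]
      · simp [or_assoc]
    have h3 := h1.union hDy (disjoint_left.2 fun b hb hbD => by
      simp only [mem_union, mem_insert, mem_singleton, mem_erase] at hb hbD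
      rcases hb with (h | h | h | h) | h
      · exact huD (h ▸ hbD.2)
      · exact hxD (h ▸ hbD.2)
      · exact hbD.1 h
      · exact htD (h ▸ hbD.2)
      · exact hDC hbD.2 h)
    convert h3 using 1
    ext b
    simp only [hT, mem_union, mem_insert, mem_singleton, mem_erase]
    by_cases hby : b = y
    · simp [hby, hy]
    · clear * - hby
      tauto
  have hzy : z ≠ y := fun h => hty (h ▸ htz)
  have hzx : z ≠ x := fun h => hxD (h ▸ hz)
  have hzu : z ≠ u := fun h => huD (h ▸ hz)
  have hzt : z ≠ t := htz.ne'
  rcases hrD with h | ⟨w, hw, hzw, hc⟩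
  · rw [h, mem_singleton] at hy
    exact absurd hy.symm hzy
  by_cases hwy : w = y
  · subst hwy
    have h1 : Cov G ({u, x, w, z, t} ∪ C) := by
      refine hr.join_left hz₁ (l := [u, x, w, z]) (a := t) ⟨?_, ?_⟩ htz₁ ?_ (.inl (by simp)) ?_
      · simp [hxu.symm, hxy, hzw.symm, htz.symm]
      · simp [hux, hyu.symm, hut, hyx.symm, hne.symm, hyt, hzu.symm, hzx.symm, hzy.symm, hzt]
      · simp [huC, hxC, htC, hDC hy, hDC hz]
      · simp [or_assoc]
    have h3 := h1.union hc (disjoint_left.2 fun b hb hbD => by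
      simp only [mem_union, mem_insert, mem_singleton, mem_erase] at hb hbD
      rcases hb with (h | h | h | h | h) | h
      · exact huD (h ▸ hbD.2.2)
      · exact hxD (h ▸ hbD.2.2)
      · exact hbD.1 h
      · exact hbD.2.1 h
      · exact htD (h ▸ hbD.2.2)
      · exact hDC hbD.2.2 h)
    convert h3 using 1
    ext b
    simp only [hT, mem_union, mem_insert, mem_singleton, mem_erase]
    by_cases hbw : b = w
    · simp [hbw, hy]
    by_cases hbz : b = z
    · simp [hbz, hz]
    clear * - hbw hbz
    tauto
  · have hwt : w ≠ t := fun h => htD (h ▸ hw)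
    have h1 : Cov G ({w, z, t} ∪ C) := by
      refine hr.join_left hz₁ (l := [w, z]) (a := t) ⟨?_, ?_⟩ htz₁ ?_ (.inl (by simp)) ?_
      · simp [hzw.symm, htz.symm]
      · simp [hzw.ne', hwt, hzt]
      · simp [htC, hDC hw, hDC hz]
      · simp [or_assoc]
    have h3 : Cov G ({u, x} ∪ (D.erase z).erase w) := by
      refine hc.append_at_leaf (v := y) (l := [u]) (a := x) ?_ (hyl.mono ?_) ⟨?_, ?_⟩ hxy ?_ ?_
      · simp [hy, hzy.symm, Ne.symm hwy]
      · exact (erase_subset _ _).trans (erase_subset _ _)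
      · simp [hxu.symm]
      · simp [hux]
      · simp [huD, hxD]
      · simp [or_assoc]
    have h4 := h1.union h3 (disjoint_left.2 fun b hb hbD => by
      have hwu : w ≠ u := fun h => huD (h ▸ hw)
      have hwx : w ≠ x := fun h => hxD (h ▸ hw)
      simp only [mem_union, mem_insert, mem_singleton, mem_erase] at hb hbD
      rcases hbD with (h' | h') | h'
      · subst h'
        rcases hb with (h | h | h) | h
        exacts [hwu h.symm, hzu h.symm, hut h, huC h]
      · subst h'
        rcases hb with (h | h | h) | h
        exacts [hwx h.symm, hzx h.symm, hne h.symm, hxC h]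
      · rcases hb with (h | h | h) | h
        exacts [h'.1 h, h'.2.1 h, htD (h ▸ h'.2.2), hDC h'.2.2 h])
    convert h4 using 1
    ext b
    simp only [hT, mem_union, mem_insert, mem_singleton, mem_erase]
    by_cases hbw : b = w
    · simp [hbw, hw]
    by_cases hbz : b = z
    · simp [hbz, hz]
    clear * - hbw hbz
    tauto

theorem false_of_lt_card_suns_deleteEdge {W S : Finset V} (hW : Conn G W)
    (hIH : ∀ D ⊂ W, Dichotomy G D)
    (hb : ∀ S ⊆ W, S.Nonempty → (suns G (W \ S)).card + 1 ≤ 2 * S.card) (hcov : ¬ Cov G W)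
    {x y : V} (hx : x ∈ W) (hy : y ∈ W) (hxy : G.Adj x y) (hyl : ¬ Leaf G W y)
    (hyL : ¬ Leafed G W y) (hch : Leafed G W x ∨ ∀ v ∈ W, ¬ Leafed G W v)
    (hG' : ∀ a b, G'.Adj a b ↔ G.Adj a b ∧ ¬ (a = x ∧ b = y) ∧ ¬ (a = y ∧ b = x))
    (hSW : S ⊆ W) (hS : S.Nonempty) (hlt : 2 * S.card + 1 ≤ (suns G' (W \ S)).card) : False := by
  obtain ⟨D₁, hD₁, D₂, hD₂, hne, hxD, hyD⟩ :=
    exists_split_of_lt_card_suns hG' (hb S hSW hS) hlt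
  have hDD := disjoint_left.1 (suns_disjoint hD₁ hD₂ hne)
  have hxS := mem_sdiff.1 ((mem_suns.1 hD₁).1.subset hxD)
  have hyS := mem_sdiff.1 ((mem_suns.1 hD₂).1.subset hyD)
  set F := ((suns G' (W \ S)).erase D₁).erase D₂ with hF
  -- The suns in `F` survive in `G`, so `S` is near-tight there and its vertices are leafed; `hch`
  -- then makes `x` leafed too.
  have hFcard : 2 * S.card ≤ F.card + 1 := by
    rw [hF, card_erase_of_mem (mem_erase.2 ⟨hne.symm, hD₂⟩), card_erase_of_mem hD₁]
    omega
  have hF' : ∀ C ∈ F, C ∈ suns G' (W \ S) ∧ Disjoint C D₁ ∧ Disjoint C D₂ := by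
    intro C hC
    simp only [hF, mem_erase] at hC
    exact ⟨hC.2.2, suns_disjoint hC.2.2 hD₁ hC.2.1, suns_disjoint hC.2.2 hD₂ hC.1⟩
  have hxF : ∀ C ∈ F, x ∉ C := fun C hC h => disjoint_left.1 (hF' C hC).2.1 h hxD
  have hyF : ∀ C ∈ F, y ∉ C := fun C hC h => disjoint_left.1 (hF' C hC).2.2 h hyD
  have hFsub : F ⊆ suns G (W \ S) := fun C hC => by
    refine suns_of_graph (hF' C hC).1 subset_rfl (mem_suns.1 (hF' C hC).1).1.subset
      fun a ha b _ => ?_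
    rw [hG']
    have : a ≠ x := fun h => hxF C hC (h ▸ ha)
    have : a ≠ y := fun h => hyF C hC (h ▸ ha)
    tauto
  have hSL : ∀ s ∈ S, ∃ v ∈ W, G.Adj s v ∧ ∀ x ∈ W, G.Adj v x → x = s := fun s hs =>
    leafed_of_near_tight hW hIH hb hcov hSW
      (hFcard.trans (Nat.add_le_add_right (card_le_card hFsub) 1)) hs
  obtain ⟨u, hu, hxu, hul⟩ : Leafed G W x := by
    refine hch.resolve_right fun h => ?_
    obtain ⟨s, hs⟩ := hS
    obtain ⟨v, hv, hsv, hvl⟩ := hSL s hs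
    exact h s (hSW hs) ⟨v, hv, hsv, Leaf.of_forall_eq hvl⟩
  have hux : ∀ b ∈ W, G.Adj u b → b = x := fun b hbW hub => hul b hbW x hx hub hxu.symm
  have huy : u ≠ y := fun h => hyl (h ▸ hul)
  have huS : u ∉ S := by
    intro huS
    obtain ⟨w, hw, huw, hwl⟩ := hSL u huS
    have hwx := hux w hw huw
    subst hwx
    exact huy (hwl y hy hxy).symm
  have hS₂W : insert x S ⊆ W := insert_subset hx hSW
  have hS₂ : (insert x S).card = S.card + 1 := card_insert_of_notMem hxS.2
  have hsub₂ : W \ insert x S ⊆ W \ S := sdiff_subset_sdiff subset_rfl (subset_insert _ _)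
  have hD₂' : D₂ ∈ suns G (W \ insert x S) := by
    have hxD₂ : x ∉ D₂ := hDD hxD
    refine suns_of_graph hD₂ hsub₂ (fun a ha => ?_) fun a ha b hbW => ?_
    · have := mem_sdiff.1 ((mem_suns.1 hD₂).1.subset ha)
      rw [mem_sdiff, mem_insert, not_or]
      exact ⟨this.1, fun h => hxD₂ (h ▸ ha), this.2⟩
    · rw [mem_sdiff, mem_insert, not_or] at hbW
      have : a ≠ x := fun h => hxD₂ (h ▸ ha)
      rw [hG']
      tauto
  -- Moving `x` into `S` adds `{u}` and `D₂` to `F`, which again misses equality by one.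
  have hnear : 2 * (insert x S).card ≤ (suns G (W \ insert x S)).card + 1 := by
    have hsub : insert {u} (insert D₂ F) ⊆ suns G (W \ insert x S) := by
      intro C hC
      rw [mem_insert, mem_insert] at hC
      rcases hC with rfl | rfl | hC
      · refine singleton_mem_suns ?_ fun b hbW hub => ?_
        · simp [hu, hxu.ne', huS]
        · simp [hux b (mem_sdiff.1 hbW).1 hub] at hbW
      · exact hD₂'
      · refine suns_anti (hFsub hC) hsub₂ fun a ha => ?_
        have := mem_sdiff.1 ((mem_suns.1 (hFsub hC)).1.subset ha)
        rw [mem_sdiff, mem_insert, not_or]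
        exact ⟨this.1, fun h => hxF C hC (h ▸ ha), this.2⟩
    have h1 : {u} ∉ insert D₂ F := by
      rw [mem_insert, not_or]
      refine ⟨fun h => huy ?_, fun h => ?_⟩
      · rw [← h, mem_singleton] at hyD
        exact hyD.symm
      · have := (mem_suns.1 (hF' _ h).1).1.closed u (mem_singleton_self u) x (mem_sdiff.2 hxS)
          ((hG' _ _).2 ⟨hxu.symm, fun h => hxu.ne' h.1, fun h => huy h.1⟩)
        exact hxu.ne (mem_singleton.1 this)
    have h2 : D₂ ∉ F := by simp [hF]
    have h3 := card_le_card hsub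
    rw [card_insert_of_notMem h1, card_insert_of_notMem h2] at h3
    omega
  have hxS₂ : x ∈ insert x S := mem_insert_self x S
  have heq := le_antisymm (hb _ hS₂W ⟨x, hxS₂⟩) hnear
  obtain ⟨f, v, hf, hfx, hf2, hv, hxv, hvl⟩ :=
    exists_assignment_of_near_tight hW hIH hb hcov hS₂W heq hxS₂
  have hfD : f D₂ ≠ x := by
    intro h
    have : D₂ ∈ (suns G (W \ insert x S)).filter (f · = x) := mem_filter.2 ⟨hD₂', h⟩
    rw [hfx, mem_singleton] at this
    rw [this, mem_singleton] at hyD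
    exact hyl (hyD ▸ Leaf.of_forall_eq hvl)
  have hD₂W : D₂ ⊆ W := (mem_suns.1 hD₂).1.subset.trans sdiff_subset
  -- A violating `X` would give `2|X| + 1` suns inside `D₂`, besides `D₁` and `F`. Then `S ∪ X ∪
  -- {y}` is near-tight and `y` is leafed.
  have hDy : ∀ X ⊆ D₂.erase y, (suns G (D₂.erase y \ X)).card ≤ 2 * X.card := by
    intro X hX
    by_contra! hX'
    have hXD : X ⊆ D₂ := hX.trans (erase_subset _ _)
    have hSX : Disjoint S X := disjoint_left.2 fun a haS haX =>
      (mem_sdiff.1 ((mem_suns.1 hD₂).1.subset (hXD haX))).2 haS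
    have hyX : y ∉ S ∪ X := by
      rw [mem_union, not_or]
      exact ⟨hyS.2, fun h => by simpa using hX h⟩
    have hS₃W : insert y (S ∪ X) ⊆ W := insert_subset hy (union_subset hSW (hXD.trans hD₂W))
    have hmem : ∀ {a}, a ∈ W \ S → a ∉ D₂ → a ∈ W \ insert y (S ∪ X) := fun {a} ha haD => by
      rw [mem_sdiff] at ha ⊢
      rw [mem_insert, mem_union, not_or, not_or]
      exact ⟨ha.1, fun h => haD (h ▸ hyD), ha.2, fun h => haD (hXD h)⟩
    have hsub₃ : W \ insert y (S ∪ X) ⊆ W \ S :=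
      sdiff_subset_sdiff subset_rfl (subset_union_left.trans (subset_insert _ _))
    have hy₃ : ∀ b ∈ W \ insert y (S ∪ X), b ≠ y := fun b hbW h => by simp [h] at hbW
    have h1 : suns G (D₂.erase y \ X) ⊆ suns G (W \ insert y (S ∪ X)) := by
      intro E hE
      have hED : ∀ {a}, a ∈ E → a ∈ D₂ ∧ a ≠ y := fun {a} ha => by
        have := (mem_suns.1 hE).1.subset ha
        rw [mem_sdiff, mem_erase] at this
        exact ⟨this.1.2, this.1.1⟩
      refine suns_of_closed hE (fun a ha => ?_) fun a ha b hbW hab => ?_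
      · rw [mem_sdiff, mem_erase] at ha
        rw [mem_sdiff, mem_insert, mem_union, not_or, not_or]
        exact ⟨hD₂W ha.1.2, ha.1.1,
          (mem_sdiff.1 ((mem_suns.1 hD₂).1.subset ha.1.2)).2, ha.2⟩
      · have hby := hy₃ b hbW
        have hbD := (mem_suns.1 hD₂).1.closed a (hED ha).1 b (hsub₃ hbW)
          ((hG' _ _).2 ⟨hab, fun h => hby h.2, fun h => (hED ha).2 h.1⟩)
        rw [mem_sdiff, mem_insert, mem_union, not_or, not_or] at hbW
        rw [mem_sdiff, mem_erase]
        exact ⟨⟨hby, hbD⟩, hbW.2.2.2⟩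
    have h2 : insert D₁ F ⊆ suns G (W \ insert y (S ∪ X)) := by
      intro C hC
      rcases mem_insert.1 hC with rfl | hC
      · refine suns_of_graph hD₁ hsub₃ (fun a ha => ?_) fun a ha b hbW => ?_
        · exact hmem ((mem_suns.1 hD₁).1.subset ha) (hDD ha)
        · have := hy₃ b hbW
          have : a ≠ y := fun h => hDD ha (h ▸ hyD)
          rw [hG']
          tauto
      · exact suns_anti (hFsub hC) hsub₃ fun a ha =>
          hmem ((mem_suns.1 (hFsub hC)).1.subset ha) (disjoint_left.1 (hF' C hC).2.2 ha)
    have h3 : Disjoint (suns G (D₂.erase y \ X)) (insert D₁ F) := by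
      rw [disjoint_left]
      intro E hE hE'
      obtain ⟨a, ha⟩ := (mem_suns.1 hE).1.conn.1
      have haD := mem_of_mem_erase (mem_sdiff.1 ((mem_suns.1 hE).1.subset ha)).1
      rcases mem_insert.1 hE' with rfl | hE'
      · exact hDD ha haD
      · exact disjoint_left.1 (hF' E hE').2.2 ha haD
    have h4 := card_le_card (union_subset h1 h2)
    have h5 : D₁ ∉ F := by simp [hF]
    rw [card_union_of_disjoint h3, card_insert_of_notMem h5] at h4
    have h6 : (insert y (S ∪ X)).card = S.card + X.card + 1 := by
      rw [card_insert_of_notMem hyX, card_union_of_disjoint hSX]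
    obtain ⟨w, hw, hyw, hwl⟩ := leafed_of_near_tight hW hIH hb hcov hS₃W (by omega)
      (mem_insert_self y _)
    exact hyL ⟨w, hw, hyw, Leaf.of_forall_eq hwl⟩
  have hDyss : D₂.erase y ⊂ W := lt_of_lt_of_le (erase_ssubset hyD) hD₂W
  have hDycov : Cov G (D₂.erase y) :=
    cov_of_card_suns_le (fun E hE => hIH E (lt_of_le_of_lt hE hDyss)) hDy
  -- A leaf neighbour of `y` in `D₂` would be an isolated vertex, hence a sun, of `D₂.erase y`,
  -- against `hDy` at `∅`.
  have hyl₂ : Leaf G D₂ y := by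
    refine ((mem_suns.1 hD₂').2 y hyD).2.resolve_right fun ⟨w, hw, hyw, hwl⟩ => ?_
    have h1 : {w} ∈ suns G (D₂.erase y \ ∅) := by
      refine singleton_mem_suns (by simp [hw, hyw.ne']) fun b hbD hwb => ?_
      rw [sdiff_empty, mem_erase] at hbD
      exact hbD.1 (hwl b hbD.2 y hyD hwb hyw.symm)
    have h2 := hDy ∅ (empty_subset _)
    rw [card_empty, mul_zero, Nat.le_zero, card_eq_zero] at h2
    rw [h2] at h1
    exact notMem_empty _ h1
  exact hcov (hf.cov_of_adj_leaf hS₂W (fun D hD hns =>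
    cov_of_not_sun (k := 1) hIH hS₂W ⟨x, hxS₂⟩ hb heq hD hns) hxS₂ hfx hf2 hD₂' hfD hxy hxv hyD
    hyl₂ hDycov)

open Classical in
/-- The number of vertices and (ordered) edges in `W`. -/
noncomputable def size {V : Type*} (G : SimpleGraph V) (W : Finset V) : ℕ :=
  W.card + ((W ×ˢ W).filter fun p => G.Adj p.1 p.2).card

omit [DecidableEq V] in
theorem size_lt_of_ssubset {D W : Finset V} (h : D ⊂ W) : size G D < size G W := by
  classical
  have h1 := card_lt_card h
  have h2 := card_le_card (filter_subset_filter (fun p : V × V => G.Adj p.1 p.2)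
    (product_subset_product h.1 h.1))
  unfold size
  convert Nat.add_lt_add_of_lt_of_le h1 h2

omit [DecidableEq V] in
theorem size_lt_of_deleteEdge {W : Finset V} {x y : V} (hx : x ∈ W) (hy : y ∈ W)
    (hxy : G.Adj x y)
    (hG' : ∀ a b, G'.Adj a b ↔ G.Adj a b ∧ ¬ (a = x ∧ b = y) ∧ ¬ (a = y ∧ b = x)) :
    size G' W < size G W := by
  unfold size
  refine Nat.add_lt_add_left (card_lt_card ?_) _
  refine (ssubset_iff_of_subset fun p hp => ?_).2 ⟨(x, y), ?_, ?_⟩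
  · simp only [mem_filter, hG'] at hp ⊢
    exact ⟨hp.1, hp.2.1⟩
  · simp [hx, hy, hxy]
  · simp [hG']

theorem dichotomy (G : SimpleGraph V) (W : Finset V) : Dichotomy G W := by
  induction hn : size G W using Nat.strong_induction_on generalizing G W with
  | _ n ih =>
  subst hn
  intro hW hb
  have hIH : ∀ D ⊂ W, Dichotomy G D := fun D hD => ih _ (size_lt_of_ssubset hD) G D rfl
  by_cases htight : ∃ S ⊆ W, S.Nonempty ∧ (suns G (W \ S)).card = 2 * S.card
  · obtain ⟨S, hSW, hS, heq⟩ := htight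
    exact .inl (cov_of_tight hW hIH hb hSW hS heq)
  push Not at htight
  have hnt : ∀ S ⊆ W, S.Nonempty → (suns G (W \ S)).card + 1 ≤ 2 * S.card := fun S hSW hS =>
    lt_of_le_of_ne (hb S hSW hS) (htight S hSW hS)
  rw [or_iff_not_imp_left]
  intro hcov
  refine sun_of_forall_leaf_or_leafed hW hIH hnt ?_
  by_contra! hno
  obtain ⟨y₀, hy₀, hyl₀, hyL₀⟩ := hno
  -- If some vertex is leafed, take an edge leaving the set of offending vertices. Its outer end `x`
  -- is no leaf, as `y` is not leafed, so `x` is leafed.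
  have hedge : ∃ x ∈ W, ∃ y ∈ W, G.Adj x y ∧ ¬ Leaf G W y ∧ ¬ Leafed G W y ∧
      (Leafed G W x ∨ ∀ v ∈ W, ¬ Leafed G W v) := by
    classical
    by_cases hL : ∀ v ∈ W, ¬ Leafed G W v
    · have : ∃ x ∈ W, G.Adj y₀ x := by
        by_contra! h
        exact hyl₀ fun a ha _ _ hya => absurd hya (h a ha)
      obtain ⟨x, hx, hyx⟩ := this
      exact ⟨x, hx, y₀, hy₀, hyx.symm, hyl₀, hyL₀, .inr hL⟩
    · push Not at hL
      obtain ⟨s, hs, hsL⟩ := hL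
      obtain ⟨y, hy, x, hx, hxB, hyx⟩ := hW.2
        (W.filter fun v => ¬ Leaf G W v ∧ ¬ Leafed G W v) (filter_subset _ _)
        ⟨y₀, by simp [hy₀, hyl₀, hyL₀]⟩ fun h => by
          rw [← h, mem_filter] at hs
          exact hs.2.2 (h ▸ hsL)
      rw [mem_filter] at hy hxB
      refine ⟨x, hx, y, hy.1, hyx.symm, hy.2.1, hy.2.2, .inl ?_⟩
      by_contra hxL
      exact hxB ⟨hx, fun hxl => hy.2.2 ⟨x, hx, hyx, hxl⟩, hxL⟩
  obtain ⟨x, hx, y, hy, hxy, hyl, hyL, hch⟩ := hedge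
  let G' : SimpleGraph V := G.deleteEdges {s(x, y)}
  have hG' : ∀ a b, G'.Adj a b ↔ G.Adj a b ∧ ¬ (a = x ∧ b = y) ∧ ¬ (a = y ∧ b = x) := by
    intro a b
    simp only [G', SimpleGraph.deleteEdges_adj, Set.mem_singleton_iff, Sym2.eq_iff]
    tauto
  by_cases hW' : Conn G' W
  · by_cases hb' : SunBound G' W
    · rcases ih _ (size_lt_of_deleteEdge hx hy hxy hG') G' W rfl hW' hb' with h | h
      · exact hcov (h.mono fun a b hab => ((hG' a b).1 hab).1)
      · exact hcov (cov_of_sun_deleteEdge hx hy hxy hyL hG' h)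
    · simp only [SunBound, not_forall, not_le] at hb'
      obtain ⟨S, hSW, hS, hlt⟩ := hb'
      exact false_of_lt_card_suns_deleteEdge hW hIH hnt hcov hx hy hxy hyl hyL hch hG' hSW hS hlt
  · simp only [Conn, hW.1, true_and, not_forall, not_exists, not_and] at hW'
    obtain ⟨A, hAW, hA, hAne, hno⟩ := hW'
    have hcut : ∀ a ∈ A, ∀ b ∈ W, b ∉ A → G.Adj a b → (a = x ∧ b = y) ∨ (a = y ∧ b = x) := by
      intro a ha b hbW hbA hab
      by_contra h
      exact hno a ha b hbW hbA ((hG' a b).2 ⟨hab, by tauto⟩)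
    obtain ⟨a, ha, b, hbW, hbA, hab⟩ := hW.2 A hAW hA hAne
    rcases hcut a ha b hbW hbA hab with ⟨rfl, rfl⟩ | ⟨rfl, rfl⟩
    · refine hcov (cov_of_bridge hW hIH hnt ha hy hbA hAW hyl hyL fun c hc d hd hdA hcd => ?_)
      exact (hcut c hc d hd hdA hcd).resolve_right fun h => hbA (h.1 ▸ hc)
    · refine hcov (cov_of_bridge hW hIH hnt (A := W \ A) (mem_sdiff.2 ⟨hx, hbA⟩) hy
        (fun h => (mem_sdiff.1 h).2 ha) sdiff_subset hyl hyL fun c hc d hd hdA hcd => ?_)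
      have hdA' : d ∈ A := by
        by_contra h
        exact hdA (mem_sdiff.2 ⟨hd, h⟩)
      have hc' := mem_sdiff.1 hc
      rcases hcut d hdA' c hc'.1 hc'.2 hcd.symm with h | h
      · exact absurd (h.1 ▸ hdA') hbA
      · exact ⟨h.2, h.1⟩

/-- The sufficiency part of Kaneko's theorem. -/
theorem cov_of_forall_card_suns_le {W : Finset V}
    (h : ∀ S ⊆ W, (suns G (W \ S)).card ≤ 2 * S.card) : Cov G W :=
  cov_of_card_suns_le (fun D _ => dichotomy G D) h

end PathCover

namespace PathCover

open Finset

/-! ### The sun bound in star-free graphs -/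

section StarFree

variable {V : Type*} {G : SimpleGraph V}

theorem not_isStarFree_of_injective {r : ℕ} {s : V} {g : Fin r → V} (hg : Function.Injective g)
    (hs : ∀ i, G.Adj s (g i)) (hi : ∀ i j, ¬ G.Adj (g i) (g j)) : ¬ G.IsStarFree r := by
  refine fun h => h ⟨⟨⟨Sum.elim (fun _ => s) g, ?_⟩, ?_⟩⟩
  · rintro (a | a) (b | b) hab
    · rw [Subsingleton.elim a b]
    · exact absurd hab (hs b).ne
    · exact absurd hab (hs a).ne'
    · rw [hg hab]
  · intro a b
    change G.Adj (Sum.elim (fun _ => s) g a) (Sum.elim (fun _ => s) g b) ↔ _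
    rcases a with a | a <;> rcases b with b | b
    · simp
    · simpa using hs b
    · simpa using (hs a).symm
    · simpa using hi a b

theorem card_suns_le_of_isStarFree [Fintype V] [DecidableEq V] [DecidableRel G.Adj] {r : ℕ}
    (hr : 3 ≤ r) (hG : G.IsStarFree r) (hd : r / 2 + 1 ≤ G.minDegree) (S : Finset V) :
    (suns G (univ \ S)).card ≤ 2 * S.card := by
  classical
  have hl : ∀ C, ∃ v, C ∈ suns G (univ \ S) → v ∈ C ∧ Leaf G C v := by
    intro C
    by_cases hC : C ∈ suns G (univ \ S)
    · obtain ⟨v, hv⟩ := (mem_suns.1 hC).1.conn.1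
      rcases ((mem_suns.1 hC).2 v hv).2 with hl | ⟨w, hw, -, hl⟩
      · exact ⟨v, fun _ => ⟨hv, hl⟩⟩
      · exact ⟨w, fun _ => ⟨hw, hl⟩⟩
    -- The value off the suns is arbitrary; it exists because the empty graph has minimum degree 0.
    · obtain ⟨v⟩ : Nonempty V := by
        by_contra h
        rw [not_nonempty_iff] at h
        simp at hd
      exact ⟨v, fun h => absurd h hC⟩
  choose l hl using hl
  have h := card_mul_le_card_mul (s := suns G (univ \ S)) (t := S) (m := r / 2) (n := r - 1)
    (fun C s => G.Adj (l C) s) ?_ ?_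
  · have h1 : r - 1 ≤ 2 * (r / 2) := by omega
    have h2 : 0 < r / 2 := by omega
    refine Nat.le_of_mul_le_mul_right (h.trans ?_) h2
    calc S.card * (r - 1) ≤ S.card * (2 * (r / 2)) := Nat.mul_le_mul_left _ h1
      _ = 2 * S.card * (r / 2) := by ring
  · intro C hC
    obtain ⟨hlC, hleaf⟩ := hl C hC
    have h1 : G.neighborFinset (l C) ⊆
        S.bipartiteAbove (fun C s => G.Adj (l C) s) C ∪ C.filter (G.Adj (l C)) := by
      intro x hx
      rw [SimpleGraph.mem_neighborFinset] at hx
      rw [mem_union, mem_bipartiteAbove, mem_filter]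
      by_cases hxS : x ∈ S
      · exact .inl ⟨hxS, hx⟩
      · exact .inr ⟨(mem_suns.1 hC).1.closed _ hlC x (by simpa using hxS) hx, hx⟩
    have h2 : (C.filter (G.Adj (l C))).card ≤ 1 := card_le_one.2 fun a ha b hb => by
      rw [mem_filter] at ha hb
      exact hleaf a ha.1 b hb.1 ha.2 hb.2
    have h3 := card_le_card h1
    rw [SimpleGraph.card_neighborFinset_eq_degree] at h3
    have h4 := G.minDegree_le_degree (l C)
    have h5 := card_union_le (S.bipartiteAbove (fun C s => G.Adj (l C) s) C)
      (C.filter (G.Adj (l C)))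
    omega
  -- Chosen leaves lie in distinct components, hence are pairwise nonadjacent; `r` of them at `s`
  -- would form an induced star.
  · intro s _
    by_contra! hlt
    set T := (suns G (univ \ S)).bipartiteBelow (fun C s => G.Adj (l C) s) s with hT
    have hmem : ∀ C ∈ T, C ∈ suns G (univ \ S) ∧ G.Adj (l C) s := fun C hC =>
      (mem_bipartiteBelow _).1 hC
    obtain ⟨φ⟩ : Nonempty (Fin r ↪ T) :=
      Function.Embedding.nonempty_of_card_le (by simpa using by omega)
    have hφ : ∀ i, (φ i : Finset V) ∈ suns G (univ \ S) := fun i => (hmem _ (φ i).2).1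
    refine not_isStarFree_of_injective (g := fun i => l (φ i)) (s := s) ?_
      (fun i => (hmem _ (φ i).2).2.symm) ?_ hG
    · intro i j hij
      refine φ.injective (Subtype.ext ?_)
      refine (mem_suns.1 (hφ i)).1.eq_of_mem (mem_suns.1 (hφ j)).1 (hl _ (hφ i)).1 ?_
      have := (hl _ (hφ j)).1
      simp only at hij
      rwa [hij]
    · intro i j hij
      have hj := (mem_suns.1 (hφ j)).1.subset (hl _ (hφ j)).1
      have h1 := (mem_suns.1 (hφ i)).1.closed _ (hl _ (hφ i)).1 _ hj hij
      have h2 := (mem_suns.1 (hφ i)).1.eq_of_mem (mem_suns.1 (hφ j)).1 h1 (hl _ (hφ j)).1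
      simp only [h2] at hij
      exact G.irrefl hij

end StarFree

/-! ### From covers to path factors -/

section PathFactor

variable {V : Type*} {G : SimpleGraph V}

/-- `φ` embeds a path as a union of components of `H`. -/
def IsClosedPath {V : Type*} (H : SimpleGraph V) {n : ℕ} (φ : Fin n → V) : Prop :=
  Function.Injective φ ∧
    ∀ i b, H.Adj (φ i) b ↔ ∃ j, b = φ j ∧ (SimpleGraph.pathGraph n).Adj i j

theorem Cov.exists_subgraph [DecidableEq V] {W : Finset V} (hW : Cov G W) :
    ∃ H ≤ G, (∀ a b, H.Adj a b → a ∈ W) ∧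
      ∀ a ∈ W, ∃ n, 3 ≤ n ∧ ∃ φ : Fin n → V, IsClosedPath H φ ∧ a ∈ Set.range φ := by
  induction hW with
  | empty => exact ⟨⊥, bot_le, by simp, by simp⟩
  | cons p W hp h3 hd _ ih =>
    obtain ⟨H, hHG, hHW, hH⟩ := ih
    have hinj : Function.Injective p.get := List.nodup_iff_injective_get.1 hp.2
    let P := (SimpleGraph.pathGraph p.length).map (⟨p.get, hinj⟩ : Fin p.length ↪ V)
    have hP : ∀ a b, P.Adj a b ↔ ∃ i j, (SimpleGraph.pathGraph p.length).Adj i j ∧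
        p.get i = a ∧ p.get j = b := SimpleGraph.map_adj _ _
    have hd := disjoint_left.1 hd
    refine ⟨H ⊔ P, sup_le hHG ?_, ?_, ?_⟩
    · intro a b hab
      obtain ⟨i, j, hij, rfl, rfl⟩ := (hP a b).1 hab
      have hc := List.isChain_iff_getElem.1 hp.1
      rw [SimpleGraph.pathGraph_adj] at hij
      rcases hij with hij | hij
      · have := hc i (by omega)
        simp only [hij] at this
        exact this
      · have := hc j (by omega)
        simp only [hij] at this
        exact this.symm
    · intro a b hab
      rcases hab with hab | hab
      · simp [hHW a b hab]
      · obtain ⟨i, j, hij, rfl, rfl⟩ := (hP a b).1 hab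
        simp
    · intro a ha
      rcases mem_union.1 ha with ha | ha
      · refine ⟨p.length, h3, p.get, ⟨hinj, fun i b => ?_⟩, ?_⟩
        · rw [SimpleGraph.sup_adj, hP]
          constructor
          · rintro (h | ⟨i', j, hij, hi, rfl⟩)
            · exact absurd (hHW _ _ h) (hd (by simp))
            · exact ⟨j, rfl, hinj hi ▸ hij⟩
          · rintro ⟨j, rfl, hij⟩
            exact .inr ⟨i, j, hij, rfl, rfl⟩
        · rw [List.mem_toFinset] at ha
          exact List.mem_iff_get.1 ha
      · obtain ⟨n, hn, φ, ⟨hφ, hadj⟩, hr⟩ := hH a ha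
        refine ⟨n, hn, φ, ⟨hφ, fun i b => ?_⟩, hr⟩
        -- A path on `n ≥ 3` vertices has no isolated vertex, so `φ i` has an `H`-neighbour; this
        -- places it in `W`, away from `p`.
        have hφW : φ i ∈ W := by
          have : Nontrivial (Fin n) := Fin.nontrivial_iff_two_le.2 (by omega)
          obtain ⟨j, hj⟩ := (SimpleGraph.pathGraph_preconnected n).exists_adj_of_nontrivial i
          exact hHW _ _ ((hadj i _).2 ⟨j, rfl, hj⟩)
        rw [SimpleGraph.sup_adj, ← hadj, hP]
        refine ⟨fun h => h.resolve_right ?_, .inl⟩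
        rintro ⟨i', j, -, hi, -⟩
        exact hd (by rw [← hi]; simp) hφW

theorem IsClosedPath.mem_range_of_reachable {H : SimpleGraph V} {n : ℕ} {φ : Fin n → V}
    (hφ : IsClosedPath H φ) {a b : V} (ha : a ∈ Set.range φ) (h : H.Reachable a b) :
    b ∈ Set.range φ := by
  obtain ⟨w⟩ := h
  induction w with
  | nil => exact ha
  | cons hab _ ih =>
    obtain ⟨i, rfl⟩ := ha
    obtain ⟨j, rfl, -⟩ := (hφ.2 i _).1 hab
    exact ih ⟨j, rfl⟩

theorem IsClosedPath.nonempty_iso {H : SimpleGraph V} {n : ℕ} {φ : Fin n → V}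
    (hφ : IsClosedPath H φ) (i : Fin n) :
    Nonempty ((H.connectedComponentMk (φ i)).toSimpleGraph ≃g SimpleGraph.pathGraph n) := by
  let f : SimpleGraph.pathGraph n →g H := ⟨φ, fun {i j} hij => (hφ.2 i _).2 ⟨j, rfl, hij⟩⟩
  have hmem : ∀ j, φ j ∈ (H.connectedComponentMk (φ i)).supp := fun j => by
    rw [SimpleGraph.ConnectedComponent.mem_supp_iff, SimpleGraph.ConnectedComponent.eq]
    exact ((SimpleGraph.pathGraph_preconnected n) j i).map f
  let e : Fin n → (H.connectedComponentMk (φ i)).supp := fun j => ⟨φ j, hmem j⟩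
  have he : Function.Bijective e := by
    refine ⟨fun j k hjk => hφ.1 (congrArg Subtype.val hjk), ?_⟩
    rintro ⟨b, hb⟩
    rw [SimpleGraph.ConnectedComponent.mem_supp_iff, SimpleGraph.ConnectedComponent.eq] at hb
    obtain ⟨j, hj⟩ := hφ.mem_range_of_reachable ⟨i, rfl⟩ hb.symm
    exact ⟨j, Subtype.ext hj⟩
  refine ⟨SimpleGraph.Iso.symm ⟨Equiv.ofBijective e he, fun {j k} => ?_⟩⟩
  change H.Adj (φ j) (φ k) ↔ _
  rw [hφ.2]
  constructor
  · rintro ⟨k', hk, h⟩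
    rwa [hφ.1 hk]
  · exact fun h => ⟨k, rfl, h⟩

theorem Cov.hasPathFactor [Fintype V] [DecidableEq V] (h : Cov G univ) : G.HasPathFactor 3 := by
  obtain ⟨H, hHG, -, hH⟩ := h.exists_subgraph
  refine ⟨H, hHG, fun C => ?_⟩
  induction C using SimpleGraph.ConnectedComponent.ind with
  | h a =>
    obtain ⟨n, hn, φ, hφ, i, rfl⟩ := hH a (mem_univ a)
    exact ⟨n, hn, hφ.nonempty_iso i⟩

end PathFactor

/-! ### Sharpness: a clique joined to disjoint edges -/

section Sharpness

variable {V : Type*} {G H : SimpleGraph V} {k : ℕ}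

theorem eq_or_eq_of_isPathFactor (hH : G.IsPathFactor k H) {s x y z : V} (hx : H.Adj s x)
    (hy : H.Adj s y) (hz : H.Adj s z) : x = y ∨ y = z ∨ x = z := by
  obtain ⟨n, -, ⟨e⟩⟩ := hH.2 (H.connectedComponentMk s)
  have hm : ∀ {v}, H.Adj s v → v ∈ (H.connectedComponentMk s).supp := fun {v} hv => by
    rw [SimpleGraph.ConnectedComponent.mem_supp_iff, SimpleGraph.ConnectedComponent.eq]
    exact hv.symm.reachable
  have hs : s ∈ (H.connectedComponentMk s).supp := rfl
  have hadj : ∀ {v} (hv : H.Adj s v), (SimpleGraph.pathGraph n).Adj (e ⟨s, hs⟩) (e ⟨v, hm hv⟩) :=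
    fun {v} hv => e.map_rel_iff.2 hv
  have hinj : ∀ {v w} (hv : H.Adj s v) (hw : H.Adj s w),
      (e ⟨v, hm hv⟩ : ℕ) = e ⟨w, hm hw⟩ → v = w := fun hv hw h =>
    congrArg Subtype.val (e.injective (Fin.ext h))
  have h1 := SimpleGraph.pathGraph_adj.1 (hadj hx)
  have h2 := SimpleGraph.pathGraph_adj.1 (hadj hy)
  have h3 := SimpleGraph.pathGraph_adj.1 (hadj hz)
  by_contra! h
  have h4 := mt (hinj hx hy) h.1
  have h5 := mt (hinj hy hz) h.2.1
  have h6 := mt (hinj hx hz) h.2.2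
  omega

/-- Otherwise the `H`-component of `a`, with at least three vertices, would lie in `{a, b}`. -/
theorem exists_adj_of_isPathFactor (hH : G.IsPathFactor 3 H) {a b : V} :
    ∃ c, c ≠ a ∧ c ≠ b ∧ (H.Adj a c ∨ H.Adj b c) := by
  by_contra! h
  have hcl : ∀ {u v}, H.Reachable u v → u = a ∨ u = b → v = a ∨ v = b := by
    rintro u v ⟨w⟩ hu
    induction w with
    | nil => exact hu
    | @cons u c v huc _ ih =>
      refine ih ?_
      by_contra! hc
      have := h c hc.1 hc.2
      rcases hu with rfl | rfl
      · exact this.1 huc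
      · exact this.2 huc
  obtain ⟨n, hn, ⟨e⟩⟩ := hH.2 (H.connectedComponentMk a)
  have hmem : ∀ i : Fin n, (e.symm i : V) = a ∨ (e.symm i : V) = b := fun i => by
    have : (e.symm i : V) ∈ (H.connectedComponentMk a).supp := (e.symm i).2
    rw [SimpleGraph.ConnectedComponent.mem_supp_iff, SimpleGraph.ConnectedComponent.eq] at this
    exact hcl this.symm (.inl rfl)
  have hinj : ∀ i j : Fin n, (e.symm i : V) = e.symm j → (i : ℕ) = j := fun i j h =>
    congrArg Fin.val (e.symm.injective (Subtype.ext h))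
  have h0 := hmem ⟨0, by omega⟩
  have h1 := hmem ⟨1, by omega⟩
  have h2 := hmem ⟨2, by omega⟩
  have h01 := mt (hinj ⟨0, by omega⟩ ⟨1, by omega⟩) (by simp)
  have h12 := mt (hinj ⟨1, by omega⟩ ⟨2, by omega⟩) (by simp)
  have h02 := mt (hinj ⟨0, by omega⟩ ⟨2, by omega⟩) (by simp)
  rcases h0 with h0 | h0 <;> rcases h1 with h1 | h1 <;> rcases h2 with h2 | h2 <;>
    simp_all

/-- The edges `a i — b i` are components of `G - S`; if there are more than `2|S|` of them, then
`G` has no path factor. -/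
theorem not_hasPathFactor_of_two_mul_card_lt {ι : Type*} [Fintype ι] (S : Finset V)
    (a b : ι → V) (ha : ∀ i x, G.Adj (a i) x → x = b i ∨ x ∈ S)
    (hb : ∀ i x, G.Adj (b i) x → x = a i ∨ x ∈ S)
    (hab : ∀ i j x, x = a i ∨ x = b i → x = a j ∨ x = b j → i = j)
    (hcard : 2 * S.card < Fintype.card ι) : ¬ G.HasPathFactor 3 := by
  classical
  rintro ⟨H, hH⟩
  have hex : ∀ i, ∃ s ∈ S, ∃ x, (x = a i ∨ x = b i) ∧ H.Adj s x := fun i => by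
    obtain ⟨c, hca, hcb, h | h⟩ := exists_adj_of_isPathFactor hH (a := a i) (b := b i)
    · exact ⟨c, (ha i c (hH.1 h)).resolve_left hcb, a i, .inl rfl, h.symm⟩
    · exact ⟨c, (hb i c (hH.1 h)).resolve_left hca, b i, .inr rfl, h.symm⟩
  choose s hs x hx hsx using hex
  -- By pigeonhole some vertex of `S` has `H`-neighbours in three of the pairs, too many for a path.
  obtain ⟨t, -, ht⟩ := exists_lt_card_fiber_of_mul_lt_card_of_maps_to (s := univ) (t := S)
    (f := s) (n := 2) (fun i _ => hs i) (by rw [card_univ]; omega)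
  obtain ⟨i, hi, j, hj, l, hl, hij, hil, hjl⟩ := two_lt_card.1 ht
  simp only [mem_filter, mem_univ, true_and] at hi hj hl
  have hinj : ∀ {i j}, x i = x j → i = j := fun {i j} h => hab i j (x i) (hx i) (h ▸ hx j)
  rcases eq_or_eq_of_isPathFactor hH (hi ▸ hsx i) (hj ▸ hsx j) (hl ▸ hsx l) with h | h | h
  · exact hij (hinj h)
  · exact hjl (hinj h)
  · exact hil (hinj h)

/-- The join of a complete graph on `p` vertices and `q` disjoint edges. -/
def joinEdges (p q : ℕ) : SimpleGraph (Fin p ⊕ Fin q × Bool) where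
  Adj
    | .inl i, .inl j => i ≠ j
    | .inl _, .inr _ => True
    | .inr _, .inl _ => True
    | .inr u, .inr v => u.1 = v.1 ∧ u.2 ≠ v.2
  symm := ⟨by
    rintro (i | u) (j | v) h
    · exact Ne.symm h
    · trivial
    · trivial
    · exact ⟨h.1.symm, h.2.symm⟩⟩
  loopless := ⟨by
    rintro (i | u) h
    · exact h rfl
    · exact h.2 rfl⟩

/-- A clique vertex is adjacent to everything else, so the leaves of an induced star lie on distinct
edges, of which there are only `q`. -/
theorem joinEdges_isStarFree {p q r : ℕ} (hr : 2 ≤ r) (hq : q < r) :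
    (joinEdges p q).IsStarFree r := by
  rintro ⟨φ⟩
  have hne : ∀ i j : Fin r, i ≠ j → φ (.inr i) ≠ φ (.inr j) := fun i j h h' =>
    h (Sum.inr_injective (φ.injective h'))
  have hnadj : ∀ i j : Fin r, ¬ (joinEdges p q).Adj (φ (.inr i)) (φ (.inr j)) := fun i j h => by
    simpa using φ.map_rel_iff.1 h
  have hinr : ∀ i, ∃ u, φ (.inr i) = .inr u := by
    intro i
    rcases hi : φ (.inr i) with c | u
    · exfalso
      have : Nontrivial (Fin r) := Fin.nontrivial_iff_two_le.2 hr
      obtain ⟨j, hj⟩ := exists_ne i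
      have h1 := hne j i hj
      have h2 := hnadj i j
      rw [hi] at h1 h2
      rcases hj' : φ (.inr j) with c' | u
      · rw [hj'] at h1 h2
        exact h2 fun h => h1 (by rw [h])
      · rw [hj'] at h2
        exact h2 trivial
    · exact ⟨u, rfl⟩
  choose u hu using hinr
  have hinj : Function.Injective fun i => (u i).1 := by
    intro i j hij
    by_contra h
    have h1 := hne i j h
    have h2 := hnadj i j
    rw [hu, hu] at h1 h2
    exact h2 ⟨hij, fun h' => h1 (congrArg _ (Prod.ext hij h'))⟩
  have := Fintype.card_le_of_injective _ hinj
  simp at this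
  omega

theorem joinEdges_minDegree {p q : ℕ} (hq : 0 < q) (hpq : p + 1 ≤ q * 2)
    [DecidableRel (joinEdges p q).Adj] : (joinEdges p q).minDegree = p + 1 := by
  classical
  have hinr : ∀ u, (joinEdges p q).degree (.inr u) = p + 1 := by
    intro u
    have : (joinEdges p q).neighborFinset (.inr u) =
        insert (.inr (u.1, !u.2)) (univ.map Function.Embedding.inl) := by
      ext (i | v)
      · simp only [SimpleGraph.mem_neighborFinset]
        simp [joinEdges]
      · simp only [SimpleGraph.mem_neighborFinset]
        obtain ⟨v, c⟩ := v
        obtain ⟨u, d⟩ := u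
        cases c <;> cases d <;> simp [joinEdges, eq_comm]
    rw [← SimpleGraph.card_neighborFinset_eq_degree, this, card_insert_of_notMem (by simp)]
    simp
  have : Nonempty (Fin p ⊕ Fin q × Bool) := ⟨.inr (⟨0, hq⟩, false)⟩
  refine le_antisymm ?_ ((joinEdges p q).le_minDegree_of_forall_le_degree _ ?_)
  · rw [← hinr (⟨0, hq⟩, false)]
    exact SimpleGraph.minDegree_le_degree _ _
  · rintro (i | u)
    · refine hpq.trans ?_
      rw [← SimpleGraph.card_neighborFinset_eq_degree]
      have : univ.map Function.Embedding.inr ⊆ (joinEdges p q).neighborFinset (.inl i) := by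
        intro x hx
        simp only [mem_map, mem_univ, true_and] at hx
        obtain ⟨u, rfl⟩ := hx
        rw [SimpleGraph.mem_neighborFinset]
        trivial
      simpa using card_le_card this
    · exact (hinr u).ge

theorem not_hasPathFactor_of_iso_joinEdges {p q : ℕ} (h : 2 * p < q)
    (e : joinEdges p q ≃g G) : ¬ G.HasPathFactor 3 := by
  have hadj : ∀ u v, G.Adj (e u) v ↔ (joinEdges p q).Adj u (e.symm v) := fun u v => by
    rw [← e.map_adj_iff, e.apply_symm_apply]
  refine not_hasPathFactor_of_two_mul_card_lt
    (univ.map (Function.Embedding.inl.trans e.toEmbedding.toEmbedding))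
    (fun i : Fin q => e (.inr (i, false))) (fun i => e (.inr (i, true))) ?_ ?_ ?_
    (by simpa using h)
  · intro i x h
    obtain ⟨y, rfl⟩ := e.surjective x
    rw [hadj, e.symm_apply_apply] at h
    rcases y with j | ⟨v, c⟩
    · simp
    · left
      obtain ⟨rfl, h⟩ : i = v ∧ false ≠ c := h
      simpa using h.symm
  · intro i x h
    obtain ⟨y, rfl⟩ := e.surjective x
    rw [hadj, e.symm_apply_apply] at h
    rcases y with j | ⟨v, c⟩
    · simp
    · left
      obtain ⟨rfl, h⟩ : i = v ∧ true ≠ c := h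
      simpa using h.symm
  · rintro i j x (rfl | rfl) h
    · simpa using h
    · simpa using h

theorem isStarFree_of_iso {V' : Type*} {G' : SimpleGraph V'} (e : G ≃g G') {r : ℕ}
    (h : G'.IsStarFree r) : G.IsStarFree r :=
  fun ⟨φ⟩ => h ⟨φ.trans e.toEmbedding⟩

end Sharpness

end PathCover

theorem mainTheorem3 (r : ℕ) (hr : 3 ≤ r) :
    (∀ (V : Type*) [Fintype V] (G : SimpleGraph V) [DecidableRel G.Adj],
      G.IsStarFree r → r / 2 + 1 ≤ G.minDegree → G.HasPathFactor 3) ∧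
    (∃ (n : ℕ) (G : SimpleGraph (Fin n)) (_ : DecidableRel G.Adj),
      G.IsStarFree r ∧ G.minDegree = r / 2 ∧ ¬ G.HasPathFactor 3) := by
  classical
  refine ⟨fun V _ G _ hG hd => ?_, ?_⟩
  · exact (PathCover.cov_of_forall_card_suns_le fun S _ =>
      PathCover.card_suns_le_of_isStarFree hr hG hd S).hasPathFactor
  -- With `p = r / 2 - 1` the minimum degree `p + 1` is `r / 2`. The number of edges is `2 * p + 1`,
  -- just above `2 * p` and still below `r`.
  · let J := PathCover.joinEdges (r / 2 - 1) (2 * (r / 2) - 1)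
    let e := SimpleGraph.Iso.map (Fintype.equivFin _) J
    refine ⟨_, J.map (Fintype.equivFin _), inferInstance, ?_, ?_, ?_⟩
    · exact PathCover.isStarFree_of_iso e.symm
        (PathCover.joinEdges_isStarFree (by omega) (by omega))
    · rw [← e.minDegree_eq, PathCover.joinEdges_minDegree (by omega) (by omega)]
      omega
    · exact PathCover.not_hasPathFactor_of_iso_joinEdges (by omega) e
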